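/- Let $1\le k\le n$ be integers and let $f:\mathbb{R}^n\to\mathbb{R}$ satisfy: (i) $f$ is $L$-smooth for some $L>0$, i.e. continuously differentiable with $\|\nabla f(x)-\nabla f(y)\|\le L\|x-y\|$ for all $x,y$; (ii) $f$ is a Łojasiewicz function with exponent $\theta\in(0,1)$, i.e. for every $x^*$ with $\nabla f(x^*)=0$ there are $\kappa,\mu>0$ such that $|f(x)-f(x^*)|^{\theta}\le\kappa\|\nabla f(x)\|$ whenever $\|x-x^*\|\le\mu$; (iii) $\inf f>-\infty$. Let $x_0\in\mathbb{R}^n$, $\delta_0\in(0,1]$, $\delta_t=\delta_0 2^{-t}$, $\eta\in\left(0,\frac{2k}{Ln}\right)$, let $V_t=[v_{t,1},\dots,v_{t,k}]$, $t=0,1,2,\dots$, be independent and uniformly distributed on the Stiefel manifold $\mathrm{St}(n,k)=\{V\in\mathbb{R}^{n\times k}: V^\top V=I_k\}$, and let $(x_t)$ be the sequence generated by stochastic zeroth-order gradient descent (SZGD), $$x_{t+1}=x_t-\eta\,\frac{n}{2\delta_t k}\sum_{i=1}^k\bigl(f(x_t+\delta_t v_{t,i})-f(x_t-\delta_t v_{t,i})\bigr)v_{t,i},\qquad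 t=0,1,2,\dots$$ Assume that (iv) $(x_t)$ is bounded with probability 1. Then $(x_t)$ converges almost surely to a random critical point $x_\infty$ of $f$, and: (a) If $\theta\in(0,\frac12]$ and $-1\le\frac{Ln\eta^2}{2k}-\eta<0$, then $(\|x_t-x_\infty\|)$ converges to $0$ linearly almost surely: if the constant $\kappa$ in (ii) can be chosen independently of the critical point $x^*$ (for instance under the normalization $\kappa=1$), there is a non-random constant $Q>1$ such that $Q^t\|x_t-x_\infty\|\to0$ almost surely; and if $\kappa$ depends on $x^*$, then almost surely there is a $Q>1$, which may depend on the realization, with $Q^t\|x_t-x_\infty\|\to0$. (b) If $\theta\in(\frac12,1)$, then almost surely $\|x_t-x_\infty\|=O\bigl(t^{\frac{1-\theta}{1-2\theta}}\bigr)$ as $t\to\infty$ (the implied constant may depend on the realization). -/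

import Mathlib

open MeasureTheory ProbabilityTheory Filter Topology Asymptotics

noncomputable section

/-! Smooth functions and the Lojasiewicz inequality on `ℝⁿ`. -/

/-- `f` is continuously differentiable with an `L`-Lipschitz gradient. -/
def IsLSmooth {n : ℕ} (f : EuclideanSpace ℝ (Fin n) → ℝ) (L : ℝ) : Prop :=
  ContDiff ℝ 1 f ∧ ∀ x y, ‖gradient f x - gradient f y‖ ≤ L * ‖x - y‖

/-- The Lojasiewicz inequality with exponent `θ` and constant `κ` on some ball around `p`. -/
def LojasiewiczAt {n : ℕ} (f : EuclideanSpace ℝ (Fin n) → ℝ) (θ κ : ℝ)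
    (p : EuclideanSpace ℝ (Fin n)) : Prop :=
  ∃ μ : ℝ, 0 < μ ∧ ∀ x, ‖x - p‖ ≤ μ → |f x - f p| ^ θ ≤ κ * ‖gradient f x‖

/-- `f` is a (differentiable) Lojasiewicz function with exponent `θ`: the Lojasiewicz inequality
holds around every critical point, with constants that may depend on the point. -/
def IsLojasiewicz {n : ℕ} (f : EuclideanSpace ℝ (Fin n) → ℝ) (θ : ℝ) : Prop :=
  Differentiable ℝ f ∧ ∀ p, gradient f p = 0 → ∃ κ : ℝ, 0 < κ ∧ LojasiewiczAt f θ κ p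

/-- As `IsLojasiewicz`, with one constant `κ` for all critical points (the normalised inequality
is the case `κ = 1`). The radius of the ball may still depend on the point. -/
def IsLojasiewiczWith {n : ℕ} (f : EuclideanSpace ℝ (Fin n) → ℝ) (θ κ : ℝ) : Prop :=
  Differentiable ℝ f ∧ ∀ p, gradient f p = 0 → LojasiewiczAt f θ κ p

/-! The uniform distribution on the Stiefel manifold. -/

/-- The orthogonal group is compact. -/
theorem isCompact_orthogonalGroup (n : ℕ) :
    IsCompact (Matrix.orthogonalGroup (Fin n) ℝ : Set (Matrix (Fin n) (Fin n) ℝ)) := by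
  have hsub : (Matrix.orthogonalGroup (Fin n) ℝ : Set (Matrix (Fin n) (Fin n) ℝ)) ⊆
      Set.pi Set.univ (fun _ => Set.pi Set.univ (fun _ => Set.Icc (-1 : ℝ) 1)) := by
    intro U hU i _ j _
    have h := entry_norm_bound_of_unitary (𝕜 := ℝ) hU i j
    rw [Real.norm_eq_abs] at h
    exact abs_le.mp h
  have hcl : IsClosed
      (Matrix.orthogonalGroup (Fin n) ℝ : Set (Matrix (Fin n) (Fin n) ℝ)) := by
    have : (Matrix.orthogonalGroup (Fin n) ℝ : Set (Matrix (Fin n) (Fin n) ℝ)) =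
        {U | U * star U = 1} := by
      ext U
      exact Matrix.mem_orthogonalGroup_iff (Fin n) ℝ
    rw [this]
    exact isClosed_eq (by fun_prop) continuous_const
  exact (isCompact_univ_pi fun _ => isCompact_univ_pi fun _ => isCompact_Icc).of_isClosed_subset
    hcl hsub

instance instCompactSpaceOrthogonalGroup (n : ℕ) :
    CompactSpace (Matrix.orthogonalGroup (Fin n) ℝ) :=
  isCompact_iff_compactSpace.mp (isCompact_orthogonalGroup n)

instance instMeasurableSpaceOrthogonalGroup (n : ℕ) :
    MeasurableSpace (Matrix.orthogonalGroup (Fin n) ℝ) := borel _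

instance instBorelSpaceOrthogonalGroup (n : ℕ) :
    BorelSpace (Matrix.orthogonalGroup (Fin n) ℝ) := ⟨rfl⟩

/-- The first `k` columns of an orthogonal matrix, an orthonormal `k`-frame of `ℝⁿ`, that is, a
point of the Stiefel manifold `St(n, k)`. -/
def frameOf {n k : ℕ} (hkn : k ≤ n) (U : Matrix.orthogonalGroup (Fin n) ℝ) :
    Fin k → EuclideanSpace ℝ (Fin n) :=
  fun i => WithLp.toLp 2 (fun r => (U : Matrix (Fin n) (Fin n) ℝ) r (Fin.castLE hkn i))

/-- The uniform distribution on the Stiefel manifold `St(n, k)`, as a measure on `k`-tuples of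
vectors: the image of the Haar probability measure of the orthogonal group `O(n)` under
`O(n) → St(n, k)`. It is the unique rotation invariant probability measure on `St(n, k)`. -/
def stiefelUniform {n k : ℕ} (hkn : k ≤ n) : Measure (Fin k → EuclideanSpace ℝ (Fin n)) :=
  (Measure.haarMeasure (⊤ : TopologicalSpace.PositiveCompacts
    (Matrix.orthogonalGroup (Fin n) ℝ))).map (frameOf hkn)

/-! The algorithm. -/

/-- The gradient estimator with directions `v₁, …, v_k` and finite difference granularity `δ`. -/
def gradEst {n k : ℕ} (f : EuclideanSpace ℝ (Fin n) → ℝ) (δ : ℝ)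
    (v : Fin k → EuclideanSpace ℝ (Fin n)) (x : EuclideanSpace ℝ (Fin n)) :
    EuclideanSpace ℝ (Fin n) :=
  ((n : ℝ) / (2 * δ * k)) • ∑ i, (f (x + δ • v i) - f (x - δ • v i)) • v i

/-- The iterates of stochastic zeroth-order gradient descent with constant step size `η`, initial
granularity `δ₀` (halved in every step), starting point `x₀`, and the frame `v t` in step `t`. -/
def szgd {n k : ℕ} (f : EuclideanSpace ℝ (Fin n) → ℝ) (η δ₀ : ℝ)
    (x₀ : EuclideanSpace ℝ (Fin n)) (v : ℕ → Fin k → EuclideanSpace ℝ (Fin n)) :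
    ℕ → EuclideanSpace ℝ (Fin n)
  | 0 => x₀
  | t + 1 => szgd f η δ₀ x₀ v t - η • gradEst f (δ₀ / 2 ^ t) (v t) (szgd f η δ₀ x₀ v t)

end

/-! ### Functions with a Lipschitz gradient -/

section Smooth

variable {F : Type*} [NormedAddCommGroup F] [InnerProductSpace ℝ F] [CompleteSpace F]
  {f : F → ℝ} {f' : F → F} {L : ℝ}

/-! Central differences along an orthonormal frame give `n / k` times the projection of `∇f (x t)`
to the span of the frame, up to an error of order `δ t`. For the allowed step sizes, `f (x t) + H /
4 ^ t` therefore drops by at least a multiple of `R t * ‖∇f (x t)‖ ^ 2 + 1 / 4 ^ t`, where `R t` is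
the squared projection length of the unit gradient direction, and the squared steps are bounded by a
multiple of the same quantity (`exists_lyapunov`).

Randomness enters only through `R t`. The new frame is independent of the past and its law is
rotation invariant, so `R t` is independent of the past, with a law that does not see the gradient
direction (`indepFun_projSq_history`). Hence the averages of `R t` tend to a constant `ρ > 0` by the
strong law (`ae_tendsto_average_projSq`), and expectations factor in the telescoped descent
inequality, which forces the gradients to zero almost surely (`ae_tendsto_zero_of_sum_projSq_le`).

The rest is deterministic. For `θ ≥ 1 / 2` the Łojasiewicz inequality turns descent into `E (t + 1)
≤ E t - c * R t * E t ^ (2 * θ)` for the gap `E` between the Lyapunov function and its limit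
(`exists_gap_recursion`); smaller exponents reduce to `1 / 2`. Since the sums of `R t` grow
linearly, `E` decays exponentially for `θ = 1 / 2` and like `t ^ (-1 / (2 * θ - 1))` beyond. Squared
steps are dominated by decrements of `E`, so the iterates are Cauchy, with a rate. The inequality is
used twice: with a constant from compactness to get convergence, then with the constant `κ` at the
limit to get the rate. -/

theorem le_quadratic_of_lipschitz_gradient (hf : ∀ x, HasGradientAt f (f' x) x)
    (hL : ∀ x y, ‖f' x - f' y‖ ≤ L * ‖x - y‖) (x v : F) :
    f (x + v) ≤ f x + inner ℝ (f' x) v + L / 2 * ‖v‖ ^ 2 := by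
  -- On `[0, 1]` this function has nonpositive derivative by the Lipschitz bound; comparing its
  -- endpoint values is the claim.
  have hder : ∀ s : ℝ, HasDerivAt
      (fun s : ℝ => f (x + s • v) - s * inner ℝ (f' x) v - L / 2 * ‖v‖ ^ 2 * s ^ 2)
      (inner ℝ (f' (x + s • v)) v - 1 * inner ℝ (f' x) v
        - L / 2 * ‖v‖ ^ 2 * ((2 : ℕ) * s ^ (2 - 1))) s := by
    intro s
    have hline : HasDerivAt (fun s : ℝ => x + s • v) v s := by
      simpa using ((hasDerivAt_id s).smul_const v).const_add x
    have h1 : HasDerivAt (fun s : ℝ => f (x + s • v)) (inner ℝ (f' (x + s • v)) v) s := by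
      have h := (hf (x + s • v)).hasFDerivAt.comp_hasDerivAt s hline
      rwa [InnerProductSpace.toDual_apply_apply] at h
    exact (h1.sub ((hasDerivAt_id s).mul_const _)).sub ((hasDerivAt_pow 2 s).const_mul _)
  have hanti := antitoneOn_of_deriv_nonpos (convex_Icc (0 : ℝ) 1)
    (fun s _ => (hder s).continuousAt.continuousWithinAt)
    (fun s _ => (hder s).differentiableAt.differentiableWithinAt) (by
      intro s hs
      rw [interior_Icc] at hs
      rw [(hder s).deriv]
      have h1 : inner ℝ (f' (x + s • v) - f' x) v ≤ L * (s * ‖v‖) * ‖v‖ := by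
        refine (real_inner_le_norm _ _).trans ?_
        refine mul_le_mul_of_nonneg_right ?_ (norm_nonneg _)
        simpa [norm_smul, abs_of_pos hs.1] using hL (x + s • v) x
      rw [inner_sub_left] at h1
      norm_num
      nlinarith)
  have h := hanti (Set.left_mem_Icc.2 zero_le_one) (Set.right_mem_Icc.2 zero_le_one) zero_le_one
  simp only [one_smul, one_mul, one_pow, mul_one, zero_smul, add_zero, zero_mul, sub_zero, ne_eq,
    OfNat.ofNat_ne_zero, not_false_eq_true, zero_pow, mul_zero] at h
  linarith

theorem abs_sub_linear_le_of_lipschitz_gradient (hf : ∀ x, HasGradientAt f (f' x) x)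
    (hL : ∀ x y, ‖f' x - f' y‖ ≤ L * ‖x - y‖) (x v : F) :
    |f (x + v) - f x - inner ℝ (f' x) v| ≤ L / 2 * ‖v‖ ^ 2 := by
  have h1 := le_quadratic_of_lipschitz_gradient hf hL x v
  have h2 := le_quadratic_of_lipschitz_gradient (f := fun x => -f x) (f' := fun x => -f' x) (L := L)
    (fun x => by
      have := (hf x).hasFDerivAt.neg
      rw [hasGradientAt_iff_hasFDerivAt, map_neg]
      exact this)
    (fun x y => by
      rw [← norm_neg]
      simpa [neg_add_eq_sub, sub_eq_add_neg, add_comm] using hL x y) x v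
  rw [inner_neg_left] at h2
  rw [abs_le]
  constructor <;> linarith

/-- The two Taylor remainders at `±δ • v` are each at most `L / 2 * δ ^ 2`, and division by `2 * δ`
leaves order `δ`. As `δ` is halved in every step, the squared errors decay like `1 / 4 ^ t`. -/
theorem abs_central_difference_le (hf : ∀ x, HasGradientAt f (f' x) x)
    (hL : ∀ x y, ‖f' x - f' y‖ ≤ L * ‖x - y‖) (x v : F) {δ : ℝ} (hδ : 0 < δ) (hv : ‖v‖ = 1) :
    |(f (x + δ • v) - f (x - δ • v)) / (2 * δ) - inner ℝ (f' x) v| ≤ L / 2 * δ := by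
  have h1 := abs_sub_linear_le_of_lipschitz_gradient hf hL x (δ • v)
  have h2 := abs_sub_linear_le_of_lipschitz_gradient hf hL x (-(δ • v))
  rw [inner_neg_right, norm_neg, ← sub_eq_add_neg] at h2
  rw [inner_smul_right] at h1 h2
  rw [norm_smul, hv, Real.norm_of_nonneg hδ.le, mul_one, abs_le] at h1 h2
  have : (f (x + δ • v) - f (x - δ • v)) / (2 * δ) - inner ℝ (f' x) v =
      (f (x + δ • v) - f (x - δ • v) - 2 * δ * inner ℝ (f' x) v) / (2 * δ) := by
    field_simp
  rw [this, abs_div, abs_of_pos (by positivity : 0 < 2 * δ), div_le_iff₀ (by positivity), abs_le]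
  constructor <;> nlinarith [h1.1, h1.2, h2.1, h2.2]

end Smooth

theorem IsLSmooth.hasGradientAt {n : ℕ} {f : EuclideanSpace ℝ (Fin n) → ℝ} {L : ℝ}
    (h : IsLSmooth f L) (x : EuclideanSpace ℝ (Fin n)) : HasGradientAt f (gradient f x) x :=
  (h.1.differentiable one_ne_zero x).hasGradientAt

theorem IsLSmooth.continuous_gradient {n : ℕ} {f : EuclideanSpace ℝ (Fin n) → ℝ} {L : ℝ}
    (h : IsLSmooth f L) (hL : 0 ≤ L) : Continuous (gradient f) :=
  (LipschitzWith.of_dist_le_mul (K := ⟨L, hL⟩) fun x y => by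
    rw [dist_eq_norm, dist_eq_norm]; exact h.2 x y).continuous

/-! ### One step of the algorithm -/

theorem Orthonormal.norm_sq_sum_smul {F ι : Type*} [NormedAddCommGroup F] [InnerProductSpace ℝ F]
    [Fintype ι] {v : ι → F} (hv : Orthonormal ℝ v) (c : ι → ℝ) :
    ‖∑ i, c i • v i‖ ^ 2 = ∑ i, c i ^ 2 := by
  rw [← real_inner_self_eq_norm_sq, hv.inner_sum]
  simp [sq]

/-- The squared norm of the orthogonal projection of `u` to the span of the frame `v`. -/
noncomputable def projSq {n k : ℕ} (v : Fin k → EuclideanSpace ℝ (Fin n)) (u : EuclideanSpace ℝ (Fin n)) : ℝ :=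
  ∑ i, inner ℝ u (v i) ^ 2

theorem projSq_nonneg {n k : ℕ} (v : Fin k → EuclideanSpace ℝ (Fin n))
    (u : EuclideanSpace ℝ (Fin n)) : 0 ≤ projSq v u :=
  Finset.sum_nonneg fun _ _ => sq_nonneg _

theorem gradEst_eq {n k : ℕ} (f : EuclideanSpace ℝ (Fin n) → ℝ) (δ : ℝ)
    (v : Fin k → EuclideanSpace ℝ (Fin n)) (x : EuclideanSpace ℝ (Fin n)) :
    gradEst f δ v x = ∑ i, ((n : ℝ) / k * ((f (x + δ • v i) - f (x - δ • v i)) / (2 * δ))) • v i := by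
  rw [gradEst, Finset.smul_sum]
  refine Finset.sum_congr rfl fun i _ => ?_
  rw [smul_smul]
  congr 1
  rw [div_mul_div_comm, div_mul_eq_mul_div]
  ring_nf

/-- One coordinate of the descent estimate: `c` is the gradient component, `e` its finite difference
error. Half of the gain `(1 - A) * c ^ 2` pays, by Young's inequality, for the cross term, whose
coefficient `2 * A - 1` has modulus at most 1. -/
theorem quadratic_descent_scalar {A c e : ℝ} (hA0 : 0 < A) (hA1 : A < 1) :
    -(c * (c + e)) + A * (c + e) ^ 2 ≤
      -((1 - A) / 2) * c ^ 2 + (1 / (2 * (1 - A)) + 1) * e ^ 2 := by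
  have hB : 0 < 1 - A := by linarith
  have h1 : (2 * A - 1) * (c * e) ≤ |c| * |e| := by
    rw [← abs_mul]
    refine (le_abs_self _).trans ?_
    rw [abs_mul]
    refine mul_le_of_le_one_left (abs_nonneg _) ?_
    rw [abs_le]; constructor <;> linarith
  have h2 : |c| * |e| ≤ (1 - A) / 2 * c ^ 2 + 1 / (2 * (1 - A)) * e ^ 2 := by
    rw [← sq_abs c, ← sq_abs e]
    have : (1 - A) / 2 * |c| ^ 2 + 1 / (2 * (1 - A)) * |e| ^ 2 - |c| * |e| =
      1 / (2 * (1 - A)) * ((1 - A) * |c| - |e|) ^ 2 := by field_simp; ring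
    have h3 : 0 ≤ 1 / (2 * (1 - A)) * ((1 - A) * |c| - |e|) ^ 2 := by positivity
    linarith
  nlinarith [sq_nonneg e]

/-- For an orthonormal frame the inner product and the squared norm in the quadratic upper bound
split into coordinates, so `quadratic_descent_scalar` applies termwise. -/
theorem exists_step_descent {n k : ℕ} (hk : 0 < k) (hkn : k ≤ n)
    {f : EuclideanSpace ℝ (Fin n) → ℝ} {L η : ℝ} (hL : 0 < L) (hf : IsLSmooth f L)
    (hη : η ∈ Set.Ioo (0 : ℝ) (2 * k / (L * n))) :
    ∃ a C : ℝ, 0 < a ∧ 0 < C ∧ ∀ (x : EuclideanSpace ℝ (Fin n)) (δ : ℝ)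
      (v : Fin k → EuclideanSpace ℝ (Fin n)), 0 < δ → Orthonormal ℝ v →
      f (x - η • gradEst f δ v x) ≤ f x - a * projSq v (gradient f x) + C * δ ^ 2 ∧
      ‖η • gradEst f δ v x‖ ^ 2 ≤ C * (projSq v (gradient f x) + δ ^ 2) := by
  have hk' : (0 : ℝ) < k := by exact_mod_cast hk
  have hn' : (0 : ℝ) < n := by exact_mod_cast hk.trans_le hkn
  obtain ⟨hη0, hη1⟩ := hη
  -- The upper bound on `η` says exactly that `A < 1`.
  set A : ℝ := L * η * (n / k) / 2 with hA
  have hA0 : 0 < A := by positivity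
  have hA1 : A < 1 := by
    rw [lt_div_iff₀ (by positivity)] at hη1
    have : A = η * (L * n) / (2 * k) := by rw [hA]; field_simp
    rw [this, div_lt_one (by positivity)]
    exact hη1
  have hB : 0 < 1 - A := by linarith
  set m : ℝ := η * (n / k) with hm
  have hm0 : 0 < m := by positivity
  set C1 : ℝ := m * (1 / (2 * (1 - A)) + 1) * (k * (L / 2) ^ 2) with hC1
  set C2 : ℝ := 2 * m ^ 2 * (1 + k * (L / 2) ^ 2) with hC2
  have hC1' : 0 < C1 := by positivity
  have hC2' : 0 < C2 := by positivity
  refine ⟨m * ((1 - A) / 2), C1 + C2, by positivity, by positivity, fun x δ v hδ hv => ?_⟩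
  set c : Fin k → ℝ := fun i => inner ℝ (gradient f x) (v i) with hc
  set w : Fin k → ℝ := fun i => (f (x + δ • v i) - f (x - δ • v i)) / (2 * δ) with hw
  set e : Fin k → ℝ := fun i => w i - c i with he
  have hwe : ∀ i, w i = c i + e i := fun i => by simp [he]
  have hesq : ∑ i, e i ^ 2 ≤ k * (L / 2) ^ 2 * δ ^ 2 := by
    calc ∑ i, e i ^ 2 ≤ ∑ _i : Fin k, (L / 2 * δ) ^ 2 := by
          refine Finset.sum_le_sum fun i _ => ?_
          have := abs_central_difference_le hf.hasGradientAt hf.2 x (v i) hδ (hv.1 i)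
          rw [sq_le_sq, abs_of_nonneg (by positivity : 0 ≤ L / 2 * δ)]
          exact this
      _ = _ := by simp; ring
  have hP : projSq v (gradient f x) = ∑ i, c i ^ 2 := rfl
  have hg : η • gradEst f δ v x = ∑ i, (m * w i) • v i := by
    rw [gradEst_eq, Finset.smul_sum]
    refine Finset.sum_congr rfl fun i _ => ?_
    rw [smul_smul, hm, hw]
    ring_nf
  have hnorm : ‖η • gradEst f δ v x‖ ^ 2 = m ^ 2 * ∑ i, (c i + e i) ^ 2 := by
    rw [hg, hv.norm_sq_sum_smul, Finset.mul_sum]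
    exact Finset.sum_congr rfl fun i _ => by rw [hwe]; ring
  have hinner : inner ℝ (gradient f x) (η • gradEst f δ v x) = m * ∑ i, c i * (c i + e i) := by
    rw [hg, inner_sum, Finset.mul_sum]
    refine Finset.sum_congr rfl fun i _ => ?_
    rw [inner_smul_right, hwe]; simp only [hc]; ring
  constructor
  · have h1 := le_quadratic_of_lipschitz_gradient hf.hasGradientAt hf.2 x (-(η • gradEst f δ v x))
    rw [← sub_eq_add_neg, norm_neg, inner_neg_right, hnorm, hinner] at h1
    have h2 : ∑ i, (-(c i * (c i + e i)) + A * (c i + e i) ^ 2) ≤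
        ∑ i, (-((1 - A) / 2) * c i ^ 2 + (1 / (2 * (1 - A)) + 1) * e i ^ 2) :=
      Finset.sum_le_sum fun i _ => quadratic_descent_scalar hA0 hA1
    rw [Finset.sum_add_distrib, Finset.sum_add_distrib, Finset.sum_neg_distrib, ← Finset.mul_sum,
      ← Finset.mul_sum, ← Finset.mul_sum] at h2
    have h3 : L / 2 * (m ^ 2 * ∑ i, (c i + e i) ^ 2) = m * (A * ∑ i, (c i + e i) ^ 2) := by
      rw [hA, hm]; ring
    have h4 := mul_le_mul_of_nonneg_left h2 hm0.le
    have h5 : m * ((1 / (2 * (1 - A)) + 1) * ∑ i, e i ^ 2) ≤ C1 * δ ^ 2 := by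
      rw [hC1, ← mul_assoc, mul_assoc (m * _)]
      exact mul_le_mul_of_nonneg_left hesq (by positivity)
    have h6 : 0 ≤ C2 * δ ^ 2 := by positivity
    rw [hP]
    nlinarith
  · rw [hnorm, hP]
    have h1 : ∑ i, (c i + e i) ^ 2 ≤ 2 * ∑ i, c i ^ 2 + 2 * ∑ i, e i ^ 2 := by
      rw [Finset.mul_sum, Finset.mul_sum, ← Finset.sum_add_distrib]
      exact Finset.sum_le_sum fun i _ => by nlinarith [sq_nonneg (c i - e i)]
    have hS : 0 ≤ ∑ i, c i ^ 2 := Finset.sum_nonneg fun _ _ => sq_nonneg _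
    calc m ^ 2 * ∑ i, (c i + e i) ^ 2
        ≤ m ^ 2 * (2 * ∑ i, c i ^ 2 + 2 * (k * (L / 2) ^ 2 * δ ^ 2)) := by gcongr; linarith
      _ ≤ C2 * (∑ i, c i ^ 2 + δ ^ 2) := by
          rw [hC2]
          have : 0 ≤ 2 * m ^ 2 * (k * (L / 2) ^ 2 * ∑ i, c i ^ 2 + δ ^ 2) := by positivity
          nlinarith
      _ ≤ (C1 + C2) * (∑ i, c i ^ 2 + δ ^ 2) := by
          gcongr; linarith

/-- The Lyapunov function `f (x t) + H / 4 ^ t` of the algorithm. -/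
theorem exists_lyapunov {n k : ℕ} (hk : 0 < k) (hkn : k ≤ n)
    {f : EuclideanSpace ℝ (Fin n) → ℝ} {L η δ₀ : ℝ} (hL : 0 < L) (hf : IsLSmooth f L)
    (hη : η ∈ Set.Ioo (0 : ℝ) (2 * k / (L * n))) (hδ₀ : δ₀ ∈ Set.Ioc (0 : ℝ) 1) :
    ∃ a H D : ℝ, 0 < a ∧ 0 < H ∧ 0 < D ∧ ∀ (x₀ : EuclideanSpace ℝ (Fin n))
      (v : ℕ → Fin k → EuclideanSpace ℝ (Fin n)), (∀ t, Orthonormal ℝ (v t)) → ∀ t : ℕ,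
      f (szgd f η δ₀ x₀ v (t + 1)) + H * (1 / 4) ^ (t + 1) +
          a * (projSq (v t) (gradient f (szgd f η δ₀ x₀ v t)) + (1 / 4) ^ t) ≤
        f (szgd f η δ₀ x₀ v t) + H * (1 / 4) ^ t ∧
      dist (szgd f η δ₀ x₀ v t) (szgd f η δ₀ x₀ v (t + 1)) ^ 2 ≤
        D * (projSq (v t) (gradient f (szgd f η δ₀ x₀ v t)) + (1 / 4) ^ t) := by
  obtain ⟨a, C, ha, hC, h⟩ := exists_step_descent hk hkn hL hf hη
  -- With this `H`, the drop `3 / 4 * H / 4 ^ t` of the correction equals `(C + a) / 4 ^ t`: it pays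
  -- for the error `C * δ ^ 2` and leaves `a / 4 ^ t`.
  refine ⟨a, 4 / 3 * (C + a), C, ha, by positivity, hC, fun x₀ v hv t => ?_⟩
  have hδ : (0 : ℝ) < δ₀ / 2 ^ t := div_pos hδ₀.1 (by positivity)
  have hδ2 : (δ₀ / 2 ^ t) ^ 2 ≤ (1 / 4 : ℝ) ^ t := by
    have : (1 / 4 : ℝ) ^ t = (1 / 2 ^ t) ^ 2 := by
      rw [← one_div_pow, ← pow_mul, mul_comm, pow_mul]; norm_num
    rw [this]
    have h1 : δ₀ / 2 ^ t ≤ 1 / 2 ^ t := by gcongr; exact hδ₀.2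
    exact pow_le_pow_left₀ hδ.le h1 2
  obtain ⟨h1, h2⟩ := h (szgd f η δ₀ x₀ v t) (δ₀ / 2 ^ t) (v t) hδ (hv t)
  have hstep : szgd f η δ₀ x₀ v (t + 1) =
    szgd f η δ₀ x₀ v t - η • gradEst f (δ₀ / 2 ^ t) (v t) (szgd f η δ₀ x₀ v t) := rfl
  constructor
  · rw [hstep, pow_succ]
    nlinarith
  · rw [dist_eq_norm, hstep, sub_sub_cancel]
    refine h2.trans ?_
    gcongr

/-! ### Recursions for the Lyapunov function -/

theorem add_rpow_le_two_rpow_mul {u w β : ℝ} (hu : 0 ≤ u) (hw : 0 ≤ w) (hβ : 0 ≤ β) :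
    (u + w) ^ β ≤ 2 ^ β * (u ^ β + w ^ β) := by
  rcases le_total u w with h | h
  · calc (u + w) ^ β ≤ (2 * w) ^ β := Real.rpow_le_rpow (by positivity) (by linarith) hβ
      _ = 2 ^ β * w ^ β := Real.mul_rpow (by norm_num) hw
      _ ≤ _ := by have := Real.rpow_nonneg hu β; gcongr; linarith
  · calc (u + w) ^ β ≤ (2 * u) ^ β := Real.rpow_le_rpow (by positivity) (by linarith) hβ
      _ = 2 ^ β * u ^ β := Real.mul_rpow (by norm_num) hu
      _ ≤ _ := by have := Real.rpow_nonneg hw β; gcongr; linarith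

/-- The Lojasiewicz inequality turns descent into a recursion for the gap to the limit value. -/
theorem exists_gap_recursion {a H K θ : ℝ} (ha : 0 < a) (hH : 0 < H) (hK : 0 < K)
    (hθ : 1 / 2 ≤ θ) :
    ∃ c : ℝ, 0 < c ∧ ∀ (y R g : ℕ → ℝ) (l : ℝ), (∀ t, R t ∈ Set.Icc (0 : ℝ) 1) →
      (∀ t, y (t + 1) + H * (1 / 4) ^ (t + 1) + a * (R t * g t ^ 2 + (1 / 4) ^ t) ≤
        y t + H * (1 / 4) ^ t) →
      (∀ t, l < y t + H * (1 / 4) ^ t) →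
      (∀ᶠ t in atTop, |y t - l| ^ θ ≤ K * g t) →
      ∀ᶠ t in atTop, y (t + 1) + H * (1 / 4) ^ (t + 1) - l ≤
        y t + H * (1 / 4) ^ t - l - c * R t * (y t + H * (1 / 4) ^ t - l) ^ (2 * θ) := by
  set B : ℝ := 2 ^ (2 * θ) * (K ^ 2 + H ^ (2 * θ)) with hB
  have hB0 : 0 < B := by positivity
  -- This constant is fixed before the sequences, which is what later makes `Q` non-random.
  refine ⟨a / B, by positivity, fun y R g l hR hdesc hl hloj => ?_⟩
  filter_upwards [hloj] with t ht
  have hq0 : (0 : ℝ) < (1 / 4) ^ t := by positivity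
  have hq1 : ((1 : ℝ) / 4) ^ t ≤ 1 := pow_le_one₀ (by norm_num) (by norm_num)
  set q : ℝ := (1 / 4) ^ t with hq
  have hE : (y t + H * q - l) ^ (2 * θ) ≤ B * (g t ^ 2 + q) := by
    have h1 : (y t + H * q - l) ^ (2 * θ) ≤ (|y t - l| + H * q) ^ (2 * θ) :=
      Real.rpow_le_rpow (by linarith [hl t]) (by linarith [le_abs_self (y t - l)]) (by linarith)
    have h2 := add_rpow_le_two_rpow_mul (abs_nonneg (y t - l)) (mul_pos hH hq0).le
      (by linarith : 0 ≤ 2 * θ)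
    have h3 : |y t - l| ^ (2 * θ) ≤ K ^ 2 * g t ^ 2 := by
      rw [mul_comm 2 θ, Real.rpow_mul (abs_nonneg _), ← mul_pow, Real.rpow_two]
      exact pow_le_pow_left₀ (Real.rpow_nonneg (abs_nonneg _) _) ht 2
    have h4 : (H * q) ^ (2 * θ) ≤ H ^ (2 * θ) * q := by
      rw [Real.mul_rpow hH.le hq0.le]
      gcongr
      -- Here `1 / 2 ≤ θ` matters: `q ≤ 1` and `2 * θ ≥ 1`.
      exact Real.rpow_le_self_of_le_one hq0.le hq1 (by linarith)
    calc _ ≤ _ := h1.trans h2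
      _ ≤ 2 ^ (2 * θ) * (K ^ 2 * g t ^ 2 + H ^ (2 * θ) * q) := by gcongr
      _ ≤ B * (g t ^ 2 + q) := by
          rw [hB, mul_assoc]
          gcongr
          have : 0 ≤ K ^ 2 * q + H ^ (2 * θ) * g t ^ 2 := by positivity
          nlinarith
  have h5 : a / B * R t * (y t + H * q - l) ^ (2 * θ) ≤ a * (R t * g t ^ 2 + q) := by
    calc _ ≤ a / B * R t * (B * (g t ^ 2 + q)) := by
          have := (hR t).1
          gcongr
      _ = a * (R t * g t ^ 2 + R t * q) := by field_simp
      _ ≤ _ := by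
          gcongr
          exact mul_le_of_le_one_left hq0.le (hR t).2
  linarith [hdesc t]

theorem eventually_half_mul_le_sum {R : ℕ → ℝ} {ρ : ℝ} (hρ : 0 < ρ)
    (h : Tendsto (fun t : ℕ => (∑ s ∈ Finset.range t, R s) / (t : ℝ)) atTop (𝓝 ρ)) :
    ∀ᶠ t : ℕ in atTop, ρ / 2 * t ≤ ∑ s ∈ Finset.range t, R s := by
  filter_upwards [h.eventually_const_lt (half_lt_self hρ), eventually_gt_atTop 0] with t ht ht0
  have : (0 : ℝ) < t := by exact_mod_cast ht0
  exact ((lt_div_iff₀ this).1 ht).le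

/-- Since `1 - c * R t ≤ exp (-(c * R t))`, the product of `E t` and `exp (c * ∑ s < t, R s)` is
eventually nonincreasing. Only the averages of `R` matter, so single `R t` may vanish. -/
theorem exists_exponential_bound {E R : ℕ → ℝ} {c ρ : ℝ} (hc : 0 < c) (hρ : 0 < ρ)
    (hE : ∀ t, 0 < E t)
    (hrec : ∀ᶠ t in atTop, E (t + 1) ≤ E t - c * R t * E t)
    (hR : Tendsto (fun t : ℕ => (∑ s ∈ Finset.range t, R s) / (t : ℝ)) atTop (𝓝 ρ)) :
    ∃ M : ℝ, ∀ᶠ t : ℕ in atTop, E t ≤ M * Real.exp (-(c * ρ / 2)) ^ t := by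
  obtain ⟨N, hN⟩ := eventually_atTop.1 hrec
  set S : ℕ → ℝ := fun t => ∑ s ∈ Finset.range t, R s with hS
  have hmono : ∀ t, N ≤ t → Real.exp (c * S t) * E t ≤ Real.exp (c * S N) * E N := by
    intro t ht
    induction t, ht using Nat.le_induction with
    | base => exact le_rfl
    | succ t ht ih =>
      refine le_trans ?_ ih
      have h1 : E (t + 1) ≤ Real.exp (-(c * R t)) * E t := by
        have h2 := Real.add_one_le_exp (-(c * R t))
        have h3 := mul_le_mul_of_nonneg_right h2 (hE t).le
        nlinarith [hN t ht]
      calc _ ≤ Real.exp (c * S (t + 1)) * (Real.exp (-(c * R t)) * E t) := by gcongr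
        _ = Real.exp (c * S t) * E t := by
          rw [← mul_assoc, ← Real.exp_add, hS]
          simp only [Finset.sum_range_succ]
          ring_nf
  refine ⟨Real.exp (c * S N) * E N, ?_⟩
  filter_upwards [eventually_ge_atTop N, eventually_half_mul_le_sum hρ hR] with t ht hSt
  have h1 := hmono t ht
  rw [← Real.exp_nat_mul]
  have h2 : Real.exp ((t : ℝ) * (c * ρ / 2)) ≤ Real.exp (c * S t) := by
    refine Real.exp_le_exp.2 ?_
    have := mul_le_mul_of_nonneg_left hSt hc.le
    linarith
  rw [mul_neg, Real.exp_neg, ← div_eq_mul_inv, le_div_iff₀ (Real.exp_pos _), mul_comm]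
  exact (mul_le_mul_of_nonneg_right h2 (hE t).le).trans h1

/-- The convex function `s ↦ s ^ (-γ)` lies above its tangent at `x`. -/
theorem rpow_neg_add_le_rpow_neg {x y γ : ℝ} (hy : 0 < y) (hyx : y ≤ x) (hγ : 0 < γ) :
    x ^ (-γ) + γ * x ^ (-(γ + 1)) * (x - y) ≤ y ^ (-γ) := by
  have hx : 0 < x := hy.trans_le hyx
  have h1 : 1 + γ * (1 - y / x) ≤ (y / x) ^ (-γ) := by
    have h2 := Real.log_le_sub_one_of_pos (div_pos hy hx)
    have h3 := Real.add_one_le_exp (Real.log (y / x) * -γ)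
    rw [Real.rpow_def_of_pos (div_pos hy hx)]
    nlinarith
  have h4 : y ^ (-γ) = x ^ (-γ) * (y / x) ^ (-γ) := by
    rw [← Real.mul_rpow hx.le (div_pos hy hx).le, mul_div_cancel₀ _ hx.ne']
  have h5 : x ^ (-(γ + 1)) = x ^ (-γ) / x := by
    rw [neg_add, Real.rpow_add hx, Real.rpow_neg_one, div_eq_mul_inv]
  rw [h4, h5]
  calc _ = x ^ (-γ) * (1 + γ * (1 - y / x)) := by field_simp
    _ ≤ _ := by gcongr

/-- Discrete form of integrating `E' = -c * R * E ^ (γ + 1)`: each step raises `E ^ (-γ)` by at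
least `γ * c * R t`. -/
theorem exists_polynomial_bound {E R : ℕ → ℝ} {c ρ γ : ℝ} (hc : 0 < c) (hρ : 0 < ρ) (hγ : 0 < γ)
    (hE : ∀ t, 0 < E t) (hanti : Antitone E)
    (hrec : ∀ᶠ t in atTop, E (t + 1) ≤ E t - c * R t * E t ^ (γ + 1))
    (hR : Tendsto (fun t : ℕ => (∑ s ∈ Finset.range t, R s) / (t : ℝ)) atTop (𝓝 ρ)) :
    ∃ M : ℝ, ∀ᶠ t : ℕ in atTop, E t ≤ M * (t : ℝ) ^ (-(1 / γ)) := by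
  obtain ⟨N, hN⟩ := eventually_atTop.1 hrec
  set S : ℕ → ℝ := fun t => ∑ s ∈ Finset.range t, R s with hS
  have hmono : ∀ t, N ≤ t → γ * c * (S t - S N) ≤ E t ^ (-γ) := by
    intro t ht
    induction t, ht using Nat.le_induction with
    | base => simpa using Real.rpow_nonneg (hE N).le _
    | succ t ht ih =>
      have h1 := rpow_neg_add_le_rpow_neg (hE (t + 1)) (hanti t.le_succ) hγ
      have h2 : E t ^ (-(γ + 1)) * E t ^ (γ + 1) = 1 := by
        rw [← Real.rpow_add (hE t)]; simp
      have h3 : γ * E t ^ (-(γ + 1)) * (c * R t * E t ^ (γ + 1)) ≤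
          γ * E t ^ (-(γ + 1)) * (E t - E (t + 1)) := by
        have := Real.rpow_pos_of_pos (hE t) (-(γ + 1))
        have := hN t ht
        gcongr
        linarith
      have h4 : γ * E t ^ (-(γ + 1)) * (c * R t * E t ^ (γ + 1)) = γ * c * R t := by
        linear_combination (γ * c * R t) * h2
      have h5 : S (t + 1) = S t + R t := Finset.sum_range_succ _ _
      rw [h5]
      nlinarith
  -- Half of the growth rate `ρ / 2` of `S t` is given up to absorb `S N` for large `t`.
  set m : ℝ := γ * c * (ρ / 4) with hm
  have hm0 : 0 < m := by positivity
  refine ⟨m ^ (-(1 / γ)), ?_⟩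
  obtain ⟨T, hT⟩ := exists_nat_ge (S N / (ρ / 4))
  filter_upwards [eventually_ge_atTop N, eventually_half_mul_le_sum hρ hR, eventually_ge_atTop T,
    eventually_gt_atTop 0] with t ht hSt htT ht0
  have ht0' : (0 : ℝ) < t := by exact_mod_cast ht0
  have h1 : S N ≤ ρ / 4 * t := by
    rw [div_le_iff₀ (by positivity)] at hT
    have : (T : ℝ) ≤ t := by exact_mod_cast htT
    nlinarith
  have h2 : m * t ≤ E t ^ (-γ) := by
    refine le_trans ?_ (hmono t ht)
    rw [hm, mul_assoc (γ * c)]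
    gcongr
    linarith
  have h3 : (E t ^ (-γ)) ^ (-(1 / γ)) = E t := by
    rw [← Real.rpow_mul (hE t).le]
    field_simp
    simp
  rw [← Real.mul_rpow hm0.le ht0'.le, ← h3]
  exact Real.rpow_le_rpow_of_nonpos (by positivity) h2 (by rw [neg_nonpos]; positivity)

/-! ### Convergence of a sequence from the decay of squared steps -/

section Steps

variable {X : Type*} [PseudoMetricSpace X] {x : ℕ → X} {E : ℕ → ℝ} {D : ℝ}

theorem exists_step_le_geometric {q : ℝ} (hq : 0 < q) (hE : ∀ t, 0 < E t) (hD : 0 < D)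
    (hstep : ∀ t, dist (x t) (x (t + 1)) ^ 2 ≤ D * (E t - E (t + 1)))
    (hbound : ∃ M : ℝ, ∀ᶠ t : ℕ in atTop, E t ≤ M * q ^ t) :
    ∃ C : ℝ, ∀ t, dist (x t) (x (t + 1)) ≤ C * √q ^ t := by
  obtain ⟨M, hM⟩ := hbound
  have hO : (fun t => dist (x t) (x (t + 1))) =O[atTop] (fun t : ℕ => √q ^ t) := by
    refine IsBigO.of_bound (√(D * M)) ?_
    filter_upwards [hM] with t ht
    have hM0 : 0 ≤ M := by
      by_contra hneg
      have := mul_neg_of_neg_of_pos (not_le.1 hneg) (pow_pos hq t)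
      linarith [hE t]
    rw [Real.norm_of_nonneg dist_nonneg, Real.norm_of_nonneg (by positivity)]
    refine abs_le_of_sq_le_sq' ?_ (by positivity) |>.2
    rw [mul_pow, Real.sq_sqrt (by positivity), ← pow_mul, mul_comm t 2, pow_mul,
      Real.sq_sqrt hq.le]
    have := hE (t + 1)
    nlinarith [hstep t]
  -- A larger constant covers the finitely many early steps.
  obtain ⟨C, -, hC⟩ := bound_of_isBigO_nat_atTop hO
  refine ⟨C, fun t => ?_⟩
  have h := hC (x := t) (by positivity)
  rwa [Real.norm_of_nonneg dist_nonneg, Real.norm_of_nonneg (by positivity)] at h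

theorem tendsto_geometric_mul_dist {r C Q : ℝ} (hr0 : 0 < r) (hr : r < 1) (hQ : 0 ≤ Q)
    (hQr : Q * r < 1) (hstep : ∀ t, dist (x t) (x (t + 1)) ≤ C * r ^ t) {p : X}
    (hp : Tendsto x atTop (𝓝 p)) : Tendsto (fun t : ℕ => Q ^ t * dist (x t) p) atTop (𝓝 0) := by
  have h1 : Tendsto (fun t : ℕ => C / (1 - r) * (Q * r) ^ t) atTop (𝓝 0) := by
    simpa using (tendsto_pow_atTop_nhds_zero_of_lt_one (by positivity) hQr).const_mul (C / (1 - r))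
  refine squeeze_zero (fun t => by positivity) (fun t => ?_) h1
  calc Q ^ t * dist (x t) p ≤ Q ^ t * (C * r ^ t / (1 - r)) := by
        gcongr
        exact dist_le_of_le_geometric_of_tendsto r C hr hstep hp t
    _ = _ := by rw [mul_pow]; ring

/-- Triangle inequality, Cauchy-Schwarz over the `s - m` steps, and telescoping. -/
theorem dist_sq_le_mul_gap (hstep : ∀ t, dist (x t) (x (t + 1)) ^ 2 ≤ D * (E t - E (t + 1)))
    {m s : ℕ} (hms : m ≤ s) : dist (x m) (x s) ^ 2 ≤ (s - m : ℕ) * (D * (E m - E s)) := by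
  calc dist (x m) (x s) ^ 2 ≤ (∑ i ∈ Finset.Ico m s, dist (x i) (x (i + 1))) ^ 2 := by
        gcongr
        exact dist_le_Ico_sum_dist x hms
    _ ≤ (Finset.Ico m s).card * ∑ i ∈ Finset.Ico m s, dist (x i) (x (i + 1)) ^ 2 :=
        sq_sum_le_card_mul_sum_sq
    _ ≤ (s - m : ℕ) * ∑ i ∈ Finset.Ico m s, D * (E i - E (i + 1)) := by
        rw [Nat.card_Ico]
        gcongr with i _
        exact hstep i
    _ = _ := by
        rw [← Finset.mul_sum]
        congr 2
        have := Finset.sum_Ico_sub E hms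
        rw [← neg_sub (E s), ← this, ← Finset.sum_neg_distrib]
        simp

/-- A dyadic Cauchy-Schwarz argument: if the squared steps are dominated by the decrements of a
quantity of order `t ^ (-(2 * α + 1))`, then the tails of the sequence have order `t ^ (-α)`. -/
theorem exists_dist_le_rpow {α : ℝ} (hα : 0 < α) (hE : ∀ t, 0 < E t) (hD : 0 < D)
    (hstep : ∀ t, dist (x t) (x (t + 1)) ^ 2 ≤ D * (E t - E (t + 1)))
    (hbound : ∃ M : ℝ, ∀ᶠ t : ℕ in atTop, E t ≤ M * (t : ℝ) ^ (-(2 * α + 1))) :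
    ∃ C : ℝ, ∀ᶠ t : ℕ in atTop, ∀ s, t ≤ s → dist (x t) (x s) ≤ C * (t : ℝ) ^ (-α) := by
  obtain ⟨M, hM⟩ := hbound
  obtain ⟨N, hN⟩ := eventually_atTop.1 (hM.and (eventually_gt_atTop 0))
  have hM0 : 0 < M := by
    obtain ⟨h1, h2⟩ := hN N le_rfl
    by_contra hneg
    have h3 : (0 : ℝ) ≤ (N : ℝ) ^ (-(2 * α + 1)) := by positivity
    have := mul_nonpos_of_nonpos_of_nonneg (not_lt.1 hneg) h3
    linarith [hE N]
  set B : ℝ := √(D * M) with hB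
  have hB0 : 0 ≤ B := Real.sqrt_nonneg _
  set r : ℝ := 2 ^ (-α) with hr
  have hr1 : r < 1 := Real.rpow_lt_one_of_one_lt_of_neg one_lt_two (by linarith)
  have hr0 : 0 < r := by positivity
  -- Over at most `t` steps, Cauchy-Schwarz yields `t * t ^ (-(2 * α + 1)) = t ^ (-(2 * α))` for the
  -- squared distance.
  have hshort : ∀ t, N ≤ t → ∀ s, t ≤ s → s ≤ 2 * t → dist (x t) (x s) ≤ B * (t : ℝ) ^ (-α) := by
    intro t ht s hts hs
    obtain ⟨h1, h2⟩ := hN t ht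
    have ht0 : (0 : ℝ) < t := by exact_mod_cast h2
    refine abs_le_of_sq_le_sq' ?_ (by positivity) |>.2
    have h3 : ((s - t : ℕ) : ℝ) ≤ t := by exact_mod_cast (by omega : s - t ≤ t)
    have h4 : D * (E t - E s) ≤ D * (M * (t : ℝ) ^ (-(2 * α + 1))) := by
      gcongr
      linarith [hE s]
    calc dist (x t) (x s) ^ 2 ≤ (s - t : ℕ) * (D * (E t - E s)) := dist_sq_le_mul_gap hstep hts
      _ ≤ (s - t : ℕ) * (D * (M * (t : ℝ) ^ (-(2 * α + 1)))) := by gcongr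
      _ ≤ t * (D * (M * (t : ℝ) ^ (-(2 * α + 1)))) := by gcongr
      _ = D * M * (t * (t : ℝ) ^ (-(2 * α + 1))) := by ring
      _ = (B * (t : ℝ) ^ (-α)) ^ 2 := by
          rw [mul_pow, hB, Real.sq_sqrt (by positivity)]
          congr 1
          rw [← Real.rpow_two, ← Real.rpow_mul ht0.le]
          nth_rw 1 [← Real.rpow_one (t : ℝ)]
          rw [← Real.rpow_add ht0]
          ring_nf
  -- Jump from `t` to `2 * t` and recurse. Doubling `t` multiplies `t ^ (-α)` by `r`, and `B / (1 -
  -- r)` solves `B + r * C = C`.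
  have hlong : ∀ d t, N ≤ t → dist (x t) (x (t + d)) ≤ B / (1 - r) * (t : ℝ) ^ (-α) := by
    intro d
    have hBr : B ≤ B / (1 - r) := by
      rw [le_div_iff₀ (by linarith)]
      nlinarith
    induction d using Nat.strong_induction_on with
    | _ d ih =>
      intro t ht
      obtain ⟨-, h2⟩ := hN t ht
      rcases le_or_gt d t with hd | hd
      · refine (hshort t ht (t + d) (by omega) (by omega)).trans ?_
        gcongr
      · have h3 := hshort t ht (2 * t) (by omega) le_rfl
        have h4 := ih (d - t) (by omega) (2 * t) (by omega)
        rw [show 2 * t + (d - t) = t + d by omega] at h4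
        push_cast at h4
        rw [Real.mul_rpow (by norm_num) (Nat.cast_nonneg t)] at h4
        calc dist (x t) (x (t + d)) ≤ _ := dist_triangle _ (x (2 * t)) _
          _ ≤ B * (t : ℝ) ^ (-α) + B / (1 - r) * (r * (t : ℝ) ^ (-α)) := add_le_add h3 h4
          _ = B / (1 - r) * (t : ℝ) ^ (-α) := by
              have : 1 - r ≠ 0 := by linarith
              field_simp
              ring
  refine ⟨B / (1 - r), ?_⟩
  filter_upwards [eventually_ge_atTop N] with t ht s hts
  have := hlong (s - t) t ht
  rwa [Nat.add_sub_cancel' hts] at this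

theorem cauchySeq_of_dist_le_rpow {α C : ℝ} (hα : 0 < α)
    (h : ∀ᶠ t : ℕ in atTop, ∀ s, t ≤ s → dist (x t) (x s) ≤ C * (t : ℝ) ^ (-α)) :
    CauchySeq x := by
  have h1 : Tendsto (fun t : ℕ => C * (t : ℝ) ^ (-α)) atTop (𝓝 0) := by
    simpa using ((tendsto_rpow_neg_atTop hα).comp tendsto_natCast_atTop_atTop).const_mul C
  rw [Metric.cauchySeq_iff']
  intro ε hε
  obtain ⟨N, h2, h3⟩ := (h.and (h1.eventually_lt_const hε)).exists
  exact ⟨N, fun s hs => by rw [dist_comm]; exact (h2 s hs).trans_lt h3⟩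

theorem isBigO_dist_of_dist_le_rpow {α C : ℝ}
    (h : ∀ᶠ t : ℕ in atTop, ∀ s, t ≤ s → dist (x t) (x s) ≤ C * (t : ℝ) ^ (-α)) {p : X}
    (hp : Tendsto x atTop (𝓝 p)) :
    (fun t => dist (x t) p) =O[atTop] (fun t : ℕ => (t : ℝ) ^ (-α)) := by
  refine IsBigO.of_bound C ?_
  filter_upwards [h] with t ht
  rw [Real.norm_of_nonneg dist_nonneg, Real.norm_of_nonneg (by positivity)]
  exact le_of_tendsto (tendsto_const_nhds.dist hp) ((eventually_ge_atTop t).mono ht)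

end Steps

/-! ### Trajectories with sufficient descent in random directions -/

/-- A sequence `x` along which `f (x t) + H / 4 ^ t` decreases at least by a multiple of
`R t * ‖∇f (x t)‖ ^ 2 + 1 / 4 ^ t`, and whose squared steps are at most a multiple of this. -/
structure IsDescentPath {n : ℕ} (f : EuclideanSpace ℝ (Fin n) → ℝ) (a H D : ℝ)
    (x : ℕ → EuclideanSpace ℝ (Fin n)) (R : ℕ → ℝ) : Prop where
  mem_Icc : ∀ t, R t ∈ Set.Icc (0 : ℝ) 1
  descent : ∀ t, f (x (t + 1)) + H * (1 / 4) ^ (t + 1) +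
    a * (R t * ‖gradient f (x t)‖ ^ 2 + (1 / 4) ^ t) ≤ f (x t) + H * (1 / 4) ^ t
  step : ∀ t, dist (x t) (x (t + 1)) ^ 2 ≤ D * (R t * ‖gradient f (x t)‖ ^ 2 + (1 / 4) ^ t)

namespace IsDescentPath

variable {n : ℕ} {f : EuclideanSpace ℝ (Fin n) → ℝ} {a H D : ℝ}
  {x : ℕ → EuclideanSpace ℝ (Fin n)} {R : ℕ → ℝ}

theorem strictAnti (h : IsDescentPath f a H D x R) (ha : 0 < a) :
    StrictAnti fun t => f (x t) + H * (1 / 4) ^ t := by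
  refine strictAnti_nat_of_succ_lt fun t => ?_
  have h1 := h.descent t
  have h2 := (h.mem_Icc t).1
  have h3 : 0 < a * (R t * ‖gradient f (x t)‖ ^ 2 + (1 / 4) ^ t) := by positivity
  linarith

/-- The descent inequality telescopes. The bound depends on the path only through `x 0`, so it can
be integrated over the probability space. -/
theorem sum_le (h : IsDescentPath f a H D x R) (ha : 0 < a) (hH : 0 < H) {m : ℝ}
    (hm : ∀ y, m ≤ f y) (N : ℕ) :
    ∑ t ∈ Finset.range N, R t * ‖gradient f (x t)‖ ^ 2 ≤ (f (x 0) + H - m) / a := by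
  have h1 : a * ∑ t ∈ Finset.range N, R t * ‖gradient f (x t)‖ ^ 2 ≤
      f (x 0) + H - (f (x N) + H * (1 / 4) ^ N) := by
    induction N with
    | zero => simp
    | succ N ih =>
      rw [Finset.sum_range_succ, mul_add]
      have h2 := h.descent N
      have h3 : 0 < a * (1 / 4 : ℝ) ^ N := by positivity
      linarith
  rw [le_div_iff₀ ha]
  have h4 := hm (x N)
  have h5 : 0 < H * (1 / 4 : ℝ) ^ N := by positivity
  linarith

/-- The strict inequality keeps the gap to `l` positive, as needed for its negative powers. -/
theorem exists_limit_value (h : IsDescentPath f a H D x R) (ha : 0 < a) (hH : 0 < H)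
    (hbdd : BddBelow (Set.range f)) :
    ∃ l, Tendsto (fun t => f (x t)) atTop (𝓝 l) ∧ ∀ t, l < f (x t) + H * (1 / 4) ^ t := by
  obtain ⟨m, hm⟩ := hbdd
  have hanti := h.strictAnti ha
  have hb : BddBelow (Set.range fun t => f (x t) + H * (1 / 4) ^ t) := by
    refine ⟨m, ?_⟩
    rintro _ ⟨t, rfl⟩
    have : m ≤ f (x t) := hm ⟨_, rfl⟩
    have : 0 < H * (1 / 4 : ℝ) ^ t := by positivity
    simp only
    linarith
  have hW := tendsto_atTop_ciInf hanti.antitone hb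
  have hq : Tendsto (fun t : ℕ => H * (1 / 4 : ℝ) ^ t) atTop (𝓝 0) := by
    simpa using (tendsto_pow_atTop_nhds_zero_of_lt_one (by norm_num : (0 : ℝ) ≤ 1 / 4)
      (by norm_num)).const_mul H
  have hlim := hW.sub hq
  simp only [add_sub_cancel_right, sub_zero] at hlim
  refine ⟨_, hlim, fun t => ?_⟩
  exact (ciInf_le hb (t + 1)).trans_lt (hanti t.lt_succ_self)

theorem dist_sq_le (h : IsDescentPath f a H D x R) (ha : 0 < a) (hD : 0 < D) (l : ℝ) (t : ℕ) :
    dist (x t) (x (t + 1)) ^ 2 ≤ D / a * ((f (x t) + H * (1 / 4) ^ t - l) -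
      (f (x (t + 1)) + H * (1 / 4) ^ (t + 1) - l)) := by
  have h1 := h.descent t
  calc _ ≤ _ := h.step t
    _ = D / a * (a * (R t * ‖gradient f (x t)‖ ^ 2 + (1 / 4) ^ t)) := by field_simp
    _ ≤ _ := by gcongr; linarith

/-- Under the Lojasiewicz inequality with exponent `1 / 2` the trajectory converges linearly, with
a rate that depends only on the constants. -/
theorem exists_linear_rate {K ρ : ℝ} (ha : 0 < a) (hH : 0 < H) (hD : 0 < D) (hK : 0 < K)
    (hρ : 0 < ρ) :
    ∃ Q : ℝ, 1 < Q ∧ ∀ (x : ℕ → EuclideanSpace ℝ (Fin n)) (R : ℕ → ℝ) (l : ℝ),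
      IsDescentPath f a H D x R →
      Tendsto (fun t : ℕ => (∑ s ∈ Finset.range t, R s) / (t : ℝ)) atTop (𝓝 ρ) →
      (∀ t, l < f (x t) + H * (1 / 4) ^ t) →
      (∀ᶠ t in atTop, |f (x t) - l| ^ (1 / 2 : ℝ) ≤ K * ‖gradient f (x t)‖) →
      CauchySeq x ∧ ∀ p, Tendsto x atTop (𝓝 p) →
        Tendsto (fun t : ℕ => Q ^ t * dist (x t) p) atTop (𝓝 0) := by
  obtain ⟨c, hc, hrec⟩ := exists_gap_recursion (θ := 1 / 2) ha hH hK le_rfl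
  have hcρ : 0 < c * ρ := by positivity
  have hr : √(Real.exp (-(c * ρ / 2))) = Real.exp (-(c * ρ / 4)) := by
    rw [Real.sqrt_eq_iff_mul_self_eq (Real.exp_pos _).le (Real.exp_pos _).le, ← Real.exp_add]
    ring_nf
  -- The gap decays like `exp (-(c * ρ / 2)) ^ t`, the steps like its square root; any `Q` below
  -- `exp (c * ρ / 4)` works.
  refine ⟨Real.exp (c * ρ / 8), Real.one_lt_exp_iff.2 (by positivity), fun x R l h hR hl hK => ?_⟩
  have h1 := hrec (fun t => f (x t)) R (fun t => ‖gradient f (x t)‖) l h.mem_Icc h.descent hl hK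
  simp only [mul_one_div_cancel (two_ne_zero' ℝ), Real.rpow_one] at h1
  have hE : ∀ t, 0 < f (x t) + H * (1 / 4) ^ t - l := fun t => sub_pos.2 (hl t)
  have h2 := exists_exponential_bound (E := fun t => f (x t) + H * (1 / 4) ^ t - l) hc hρ hE h1 hR
  obtain ⟨C, hC⟩ := exists_step_le_geometric (Real.exp_pos _) hE (div_pos hD ha)
    (h.dist_sq_le ha hD l) h2
  rw [hr] at hC
  have hr1 : Real.exp (-(c * ρ / 4)) < 1 := Real.exp_lt_one_iff.2 (by linarith)
  refine ⟨cauchySeq_of_le_geometric _ C hr1 hC, fun p hp => ?_⟩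
  refine tendsto_geometric_mul_dist (Real.exp_pos _) hr1 (Real.exp_pos _).le ?_ hC hp
  rw [← Real.exp_add]
  exact Real.exp_lt_one_iff.2 (by linarith)

/-- Under the Lojasiewicz inequality with exponent larger than `1 / 2` the trajectory converges
at a polynomial rate. -/
theorem cauchySeq_and_isBigO {K ρ θ l : ℝ} (ha : 0 < a) (hH : 0 < H) (hD : 0 < D) (hK : 0 < K)
    (hρ : 0 < ρ) (hθ : θ ∈ Set.Ioo (1 / 2 : ℝ) 1) (h : IsDescentPath f a H D x R)
    (hR : Tendsto (fun t : ℕ => (∑ s ∈ Finset.range t, R s) / (t : ℝ)) atTop (𝓝 ρ))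
    (hl : ∀ t, l < f (x t) + H * (1 / 4) ^ t)
    (hloj : ∀ᶠ t in atTop, |f (x t) - l| ^ θ ≤ K * ‖gradient f (x t)‖) :
    CauchySeq x ∧ ∀ p, Tendsto x atTop (𝓝 p) → (fun t => dist (x t) p) =O[atTop]
      (fun t : ℕ => (t : ℝ) ^ ((1 - θ) / (1 - 2 * θ))) := by
  obtain ⟨hθ1, hθ2⟩ := hθ
  obtain ⟨c, hc, hrec⟩ := exists_gap_recursion ha hH hK hθ1.le
  have h1 := hrec (fun t => f (x t)) R (fun t => ‖gradient f (x t)‖) l h.mem_Icc h.descent hl hloj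
  have hγ : 0 < 2 * θ - 1 := by linarith
  rw [show 2 * θ = (2 * θ - 1) + 1 by ring] at h1
  have hE : ∀ t, 0 < f (x t) + H * (1 / 4) ^ t - l := fun t => sub_pos.2 (hl t)
  have hanti : Antitone fun t => f (x t) + H * (1 / 4) ^ t - l := fun s t hst =>
    sub_le_sub_right ((h.strictAnti ha).antitone hst) l
  have h2 := exists_polynomial_bound (E := fun t => f (x t) + H * (1 / 4) ^ t - l) hc hρ hγ hE
    hanti h1 hR
  -- Chosen so that `2 * α + 1 = 1 / (2 * θ - 1)`, the decay exponent of the gap.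
  set α : ℝ := (1 - θ) / (2 * θ - 1) with hα
  have hα0 : 0 < α := div_pos (by linarith) hγ
  have h3 : -(1 / (2 * θ - 1)) = -(2 * α + 1) := by
    rw [hα]; field_simp; ring
  rw [h3] at h2
  obtain ⟨C, hC⟩ := exists_dist_le_rpow hα0 hE (div_pos hD ha) (h.dist_sq_le ha hD l) h2
  refine ⟨cauchySeq_of_dist_le_rpow hα0 hC, fun p hp => ?_⟩
  have h4 : (1 - θ) / (1 - 2 * θ) = -α := by
    rw [hα, ← div_neg]; ring_nf
  rw [h4]
  exact isBigO_dist_of_dist_le_rpow hC hp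

end IsDescentPath

/-! ### The Lojasiewicz inequality along a sequence -/

section Lojasiewicz

variable {n : ℕ} {f : EuclideanSpace ℝ (Fin n) → ℝ} {θ l : ℝ} {x : ℕ → EuclideanSpace ℝ (Fin n)}

theorem eventually_lojasiewicz_of_tendsto {κ : ℝ} {p : EuclideanSpace ℝ (Fin n)}
    (hp : Tendsto x atTop (𝓝 p)) (h : LojasiewiczAt f θ κ p) :
    ∀ᶠ t in atTop, |f (x t) - f p| ^ θ ≤ κ * ‖gradient f (x t)‖ := by
  obtain ⟨μ, hμ, h⟩ := h
  filter_upwards [hp (Metric.closedBall_mem_nhds p hμ)] with t ht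
  exact h _ (by simpa [dist_eq_norm] using ht)

/-- A bounded sequence along which the gradient tends to zero and the values converge satisfies
the Lojasiewicz inequality with one constant. -/
theorem exists_eventually_lojasiewicz (hf : Continuous f) (hf' : Continuous (gradient f))
    (hloj : IsLojasiewicz f θ) (hx : Bornology.IsBounded (Set.range x))
    (hl : Tendsto (fun t => f (x t)) atTop (𝓝 l))
    (hgrad : Tendsto (fun t => gradient f (x t)) atTop (𝓝 0)) :
    ∃ K : ℝ, 0 < K ∧ ∀ᶠ t in atTop, |f (x t) - l| ^ θ ≤ K * ‖gradient f (x t)‖ := by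
  have key : ∃ K : ℝ, 0 < K ∧ ∀ᶠ t in atTop, x t ∈ closure (Set.range x) →
      |f (x t) - l| ^ θ ≤ K * ‖gradient f (x t)‖ := by
    -- Compactness reduces the claim to one point `p`. A cluster point is critical with value `l`,
    -- so the Łojasiewicz inequality holds near it; any other point has a neighbourhood that the
    -- sequence eventually avoids.
    refine hx.isCompact_closure.induction_on
      (p := fun s => ∃ K : ℝ, 0 < K ∧ ∀ᶠ t in atTop, x t ∈ s →
        |f (x t) - l| ^ θ ≤ K * ‖gradient f (x t)‖)
      ⟨1, one_pos, by simp⟩ ?_ ?_ ?_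
    · rintro s t hst ⟨K, hK, h⟩
      exact ⟨K, hK, h.mono fun i hi his => hi (hst his)⟩
    · rintro s t ⟨K, hK, h⟩ ⟨K', hK', h'⟩
      refine ⟨max K K', lt_max_of_lt_left hK, ?_⟩
      filter_upwards [h, h'] with i hi hi' his
      rcases his with his | his
      · exact (hi his).trans (by gcongr; exact le_max_left _ _)
      · exact (hi' his).trans (by gcongr; exact le_max_right _ _)
    · intro p _
      by_cases hcl : MapClusterPt p atTop x
      · obtain ⟨U, hU, hUp⟩ := mapClusterPt_iff_ultrafilter.1 hcl
        have hfp : f p = l :=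
          tendsto_nhds_unique ((hf.tendsto p).comp hUp) (hl.mono_left hU)
        have hgp : gradient f p = 0 :=
          tendsto_nhds_unique ((hf'.tendsto p).comp hUp) (hgrad.mono_left hU)
        obtain ⟨κ, hκ, μ, hμ, h⟩ := hloj.2 p hgp
        refine ⟨Metric.closedBall p μ,
          mem_nhdsWithin_of_mem_nhds (Metric.closedBall_mem_nhds p hμ), κ, hκ,
          Eventually.of_forall fun t ht => ?_⟩
        rw [← hfp]
        exact h _ (by simpa [dist_eq_norm] using ht)
      · rw [mapClusterPt_iff_frequently] at hcl
        push Not at hcl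
        obtain ⟨s, hs, h⟩ := hcl
        exact ⟨s, mem_nhdsWithin_of_mem_nhds hs, 1, one_pos, h.mono fun t ht hts => (ht hts).elim⟩
  obtain ⟨K, hK, h⟩ := key
  exact ⟨K, hK, h.mono fun t ht => ht (subset_closure ⟨t, rfl⟩)⟩

/-- Once `|f (x t) - l| < 1`, a larger exponent gives a smaller power. -/
theorem eventually_lojasiewicz_half {K : ℝ} (hθ : 0 < θ) (hθ' : θ ≤ 1 / 2)
    (hl : Tendsto (fun t => f (x t)) atTop (𝓝 l))
    (h : ∀ᶠ t in atTop, |f (x t) - l| ^ θ ≤ K * ‖gradient f (x t)‖) :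
    ∀ᶠ t in atTop, |f (x t) - l| ^ (1 / 2 : ℝ) ≤ K * ‖gradient f (x t)‖ := by
  have h1 : ∀ᶠ t in atTop, |f (x t) - l| < 1 := by
    have := Metric.tendsto_nhds.1 hl 1 one_pos
    simpa [Real.dist_eq] using this
  filter_upwards [h, h1] with t ht ht1
  exact (Real.rpow_le_rpow_of_exponent_ge' (abs_nonneg _) ht1.le hθ.le hθ').trans ht

end Lojasiewicz

/-! ### The uniform distribution on the Stiefel manifold -/

section Stiefel

variable {n k : ℕ}

/-- Application of an orthogonal matrix to a vector. -/
noncomputable def rotate (U : Matrix.orthogonalGroup (Fin n) ℝ) (u : EuclideanSpace ℝ (Fin n)) :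
    EuclideanSpace ℝ (Fin n) :=
  WithLp.toLp 2 ((U : Matrix (Fin n) (Fin n) ℝ).mulVec u.ofLp)

theorem inner_rotate_rotate (U : Matrix.orthogonalGroup (Fin n) ℝ)
    (u w : EuclideanSpace ℝ (Fin n)) : inner ℝ (rotate U u) (rotate U w) = inner ℝ u w := by
  have hU : (U : Matrix (Fin n) (Fin n) ℝ).transpose * (U : Matrix (Fin n) (Fin n) ℝ) = 1 :=
    (Matrix.mem_orthogonalGroup_iff' (Fin n) ℝ).1 U.2
  simp only [rotate, EuclideanSpace.inner_eq_star_dotProduct, star_trivial]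
  rw [Matrix.dotProduct_mulVec, Matrix.vecMul_mulVec, ← Matrix.dotProduct_mulVec, hU,
    Matrix.one_mulVec]

/-- The orthogonal group acts transitively on spheres. -/
theorem exists_rotate_eq {u w : EuclideanSpace ℝ (Fin n)} (h : ‖u‖ = ‖w‖) :
    ∃ U : Matrix.orthogonalGroup (Fin n) ℝ, rotate U u = w := by
  -- The Householder reflection that swaps `u` and `w`.
  set φ := (Submodule.span ℝ {u - w})ᗮ.reflection with hφ
  set M : Matrix (Fin n) (Fin n) ℝ := LinearMap.toMatrix
    (EuclideanSpace.basisFun (Fin n) ℝ).toBasis (EuclideanSpace.basisFun (Fin n) ℝ).toBasis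
    φ.toLinearEquiv.toLinearMap with hM
  have hMmem : M ∈ Matrix.orthogonalGroup (Fin n) ℝ := by
    rw [Matrix.mem_orthogonalGroup_iff']
    ext i j
    have h1 : inner ℝ (φ (EuclideanSpace.basisFun (Fin n) ℝ i))
        (φ (EuclideanSpace.basisFun (Fin n) ℝ j)) = if i = j then (1 : ℝ) else 0 := by
      rw [φ.inner_map_map]
      exact orthonormal_iff_ite.1 (EuclideanSpace.basisFun (Fin n) ℝ).orthonormal i j
    rw [Matrix.one_apply, ← h1, Matrix.mul_apply, PiLp.inner_apply]
    refine Finset.sum_congr rfl fun r _ => ?_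
    simp [hM, LinearMap.toMatrix_apply, mul_comm]
  refine ⟨⟨M, hMmem⟩, ?_⟩
  have h2 : φ u = w := Submodule.reflection_sub h
  rw [← h2]
  have h3 := LinearMap.toMatrix_mulVec_repr (EuclideanSpace.basisFun (Fin n) ℝ).toBasis
    (EuclideanSpace.basisFun (Fin n) ℝ).toBasis φ.toLinearEquiv.toLinearMap u
  have h4 : ⇑((EuclideanSpace.basisFun (Fin n) ℝ).toBasis.repr u) = u.ofLp := by
    ext i
    simp
  rw [h4] at h3
  ext i
  have h5 := congrFun h3 i
  simp only [OrthonormalBasis.coe_toBasis_repr_apply, EuclideanSpace.basisFun_repr] at h5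
  exact h5

theorem frameOf_mul (hkn : k ≤ n) (U W : Matrix.orthogonalGroup (Fin n) ℝ) (i : Fin k) :
    frameOf hkn (U * W) i = rotate U (frameOf hkn W i) := by
  ext r
  simp [frameOf, rotate, Matrix.mul_apply, Matrix.mulVec, dotProduct]

theorem orthonormal_frameOf (hkn : k ≤ n) (U : Matrix.orthogonalGroup (Fin n) ℝ) :
    Orthonormal ℝ (frameOf hkn U) := by
  have hU : (U : Matrix (Fin n) (Fin n) ℝ).transpose * (U : Matrix (Fin n) (Fin n) ℝ) = 1 :=
    (Matrix.mem_orthogonalGroup_iff' (Fin n) ℝ).1 U.2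
  rw [orthonormal_iff_ite]
  intro i j
  have h1 := congrFun (congrFun hU (Fin.castLE hkn i)) (Fin.castLE hkn j)
  rw [Matrix.mul_apply, Matrix.one_apply] at h1
  simp only [Fin.castLE_inj, Matrix.transpose_apply] at h1
  rw [← h1, PiLp.inner_apply]
  exact Finset.sum_congr rfl fun r _ => by simp [frameOf, mul_comm]

theorem measurable_frameOf (hkn : k ≤ n) : Measurable (frameOf (n := n) hkn) := by
  refine Continuous.measurable ?_
  unfold frameOf
  refine continuous_pi fun i => (PiLp.continuous_toLp 2 _).comp (continuous_pi fun r => ?_)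
  exact (continuous_apply_apply r _).comp continuous_subtype_val

instance isProbabilityMeasure_stiefelUniform (hkn : k ≤ n) :
    IsProbabilityMeasure (stiefelUniform (n := n) hkn) := by
  have : IsProbabilityMeasure (Measure.haarMeasure
      (⊤ : TopologicalSpace.PositiveCompacts (Matrix.orthogonalGroup (Fin n) ℝ))) :=
    ⟨by rw [← TopologicalSpace.PositiveCompacts.coe_top]; exact Measure.haarMeasure_self⟩
  exact Measure.isProbabilityMeasure_map (measurable_frameOf hkn).aemeasurable

theorem Measurable.projSq {α : Type*} [MeasurableSpace α]
    {v : α → Fin k → EuclideanSpace ℝ (Fin n)} {u : α → EuclideanSpace ℝ (Fin n)}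
    (hv : Measurable v) (hu : Measurable u) : Measurable fun a => projSq (v a) (u a) := by
  unfold _root_.projSq
  exact Finset.measurable_fun_sum _ fun i _ =>
    (hu.inner ((measurable_pi_apply i).comp hv)).pow_const 2

theorem measurable_projSq_left (u : EuclideanSpace ℝ (Fin n)) :
    Measurable fun v : Fin k → EuclideanSpace ℝ (Fin n) => projSq v u :=
  measurable_id.projSq measurable_const

theorem measurableSet_orthonormal :
    MeasurableSet {v : Fin k → EuclideanSpace ℝ (Fin n) | Orthonormal ℝ v} := by
  have h : {v : Fin k → EuclideanSpace ℝ (Fin n) | Orthonormal ℝ v} =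
      ⋂ i, ⋂ j, {v | inner ℝ (v i) (v j) = if i = j then (1 : ℝ) else 0} := by
    ext v
    simp [orthonormal_iff_ite]
  rw [h]
  refine IsClosed.measurableSet (isClosed_iInter fun i => isClosed_iInter fun j =>
    isClosed_eq ?_ continuous_const)
  fun_prop

theorem ae_orthonormal_stiefelUniform (hkn : k ≤ n) :
    ∀ᵐ v ∂stiefelUniform hkn, Orthonormal ℝ v :=
  (ae_map_iff (measurable_frameOf hkn).aemeasurable measurableSet_orthonormal).2
    (Eventually.of_forall (orthonormal_frameOf hkn))

theorem projSq_le {v : Fin k → EuclideanSpace ℝ (Fin n)} (hv : Orthonormal ℝ v)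
    (u : EuclideanSpace ℝ (Fin n)) : projSq v u ≤ ‖u‖ ^ 2 := by
  have := hv.sum_inner_products_le (s := Finset.univ) u
  simpa [projSq, real_inner_comm] using this

theorem projSq_smul (v : Fin k → EuclideanSpace ℝ (Fin n)) (c : ℝ)
    (u : EuclideanSpace ℝ (Fin n)) : projSq v (c • u) = projSq v u * c ^ 2 := by
  rw [projSq, projSq, Finset.sum_mul]
  exact Finset.sum_congr rfl fun i _ => by rw [real_inner_smul_left]; ring

/-- The law of the squared projection length does not depend on the direction. -/
theorem map_projSq_eq (hkn : k ≤ n) {u w : EuclideanSpace ℝ (Fin n)} (h : ‖u‖ = ‖w‖) :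
    (stiefelUniform hkn).map (fun v => projSq v u) =
      (stiefelUniform hkn).map (fun v => projSq v w) := by
  obtain ⟨U, hU⟩ := exists_rotate_eq h
  have hmeas : ∀ z : EuclideanSpace ℝ (Fin n), Measurable
      fun W : Matrix.orthogonalGroup (Fin n) ℝ => projSq (frameOf hkn W) z := fun z =>
    (measurable_projSq_left z).comp (measurable_frameOf hkn)
  -- Rotating frame and vector together preserves inner products; left invariance of Haar measure
  -- then removes the rotation of the frame.
  have hinv : (fun W => projSq (frameOf hkn (U * W)) w) = fun W => projSq (frameOf hkn W) u := by
    funext W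
    rw [← hU]
    simp only [projSq, frameOf_mul, inner_rotate_rotate]
  have key : ∀ (m : Measure (Matrix.orthogonalGroup (Fin n) ℝ)), m.IsMulLeftInvariant →
      m.map (fun W => projSq (frameOf hkn W) u) = m.map (fun W => projSq (frameOf hkn W) w) := by
    intro m hm
    rw [← hinv]
    conv_rhs => rw [← hm.map_mul_left_eq_self U]
    rw [Measure.map_map (hmeas w) (measurable_const_mul U)]
    rfl
  rw [stiefelUniform, Measure.map_map (measurable_projSq_left u) (measurable_frameOf hkn),
    Measure.map_map (measurable_projSq_left w) (measurable_frameOf hkn)]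
  exact key _ inferInstance

/-- The mean of the squared projection length of a unit vector is positive (it is `k / n`). -/
theorem integral_projSq_pos (hk : 0 < k) (hkn : k ≤ n) {e : EuclideanSpace ℝ (Fin n)}
    (he : ‖e‖ = 1) : 0 < ∫ v, projSq v e ∂stiefelUniform hkn := by
  have hmeas := measurable_projSq_left (n := n) (k := k)
  have hint : ∀ z : EuclideanSpace ℝ (Fin n),
      Integrable (fun v => projSq v z) (stiefelUniform (k := k) hkn) := fun z => by
    refine Integrable.of_bound (hmeas z).aestronglyMeasurable (‖z‖ ^ 2) ?_
    filter_upwards [ae_orthonormal_stiefelUniform hkn] with v hv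
    rw [Real.norm_of_nonneg (projSq_nonneg _ _)]
    exact projSq_le hv z
  -- The projections of the `n` basis vectors have equal means by invariance, and they sum to `k`
  -- because each frame vector has norm 1.
  set b := EuclideanSpace.basisFun (Fin n) ℝ with hb
  have h1 : ∀ j, ∫ v, projSq v (b j) ∂stiefelUniform (k := k) hkn =
      ∫ v, projSq v e ∂stiefelUniform hkn := fun j => by
    have h2 := map_projSq_eq (k := k) hkn (u := b j) (w := e) (by rw [he]; exact b.norm_eq_one j)
    rw [← integral_map (f := fun r : ℝ => r) (hmeas _).aemeasurable (by fun_prop),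
      ← integral_map (f := fun r : ℝ => r) (hmeas _).aemeasurable (by fun_prop), h2]
  have h4 : ∀ᵐ v ∂stiefelUniform (k := k) hkn, ∑ j, projSq v (b j) = k := by
    filter_upwards [ae_orthonormal_stiefelUniform hkn] with v hv
    simp only [projSq]
    rw [Finset.sum_comm]
    have : ∀ i, ∑ j, inner ℝ (b j) (v i) ^ 2 = (1 : ℝ) := fun i => by
      have := b.sum_sq_norm_inner_right (v i)
      simpa [hv.1 i] using this
    simp [this]
  have h5 : (n : ℝ) * ∫ v, projSq v e ∂stiefelUniform hkn = k := by
    have h6 := integral_congr_ae h4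
    rw [integral_finsetSum _ fun j _ => hint _] at h6
    simpa [h1] using h6
  have hk' : (0 : ℝ) < k := by exact_mod_cast hk
  have hn' : (0 : ℝ) < n := by exact_mod_cast hk.trans_le hkn
  rw [← h5] at hk'
  exact (mul_pos_iff_of_pos_left hn').1 hk'

end Stiefel

/-! ### Independence of the projection lengths -/

section Independence

variable {Ω α β γ : Type*} [MeasurableSpace Ω] [MeasurableSpace α] [MeasurableSpace β]
  [MeasurableSpace γ] {P : Measure Ω} [IsProbabilityMeasure P]

/-- If `X` and `Y` are independent and the law of `g X y` does not depend on `y`, then `g X Y` has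
this law and is independent of `Y`. -/
theorem indepFun_of_map_const {X : Ω → α} {Y : Ω → β} (hX : Measurable X) (hY : Measurable Y)
    (hXY : X ⟂ᵢ[P] Y) {g : α → β → γ} (hg : Measurable (Function.uncurry g)) {ν : Measure γ}
    [IsProbabilityMeasure ν] (hν : ∀ y, (P.map X).map (fun a => g a y) = ν) :
    (fun ω => g (X ω) (Y ω)) ⟂ᵢ[P] Y ∧ P.map (fun ω => g (X ω) (Y ω)) = ν := by
  have hgm : Measurable fun ω => g (X ω) (Y ω) := hg.comp (hX.prodMk hY)
  have := Measure.isProbabilityMeasure_map (μ := P) hX.aemeasurable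
  have := Measure.isProbabilityMeasure_map (μ := P) hY.aemeasurable
  -- For each fixed `y` the law of `g X y` is `ν`, so Fubini makes the joint law a product.
  have hjoint : P.map (fun ω => (g (X ω) (Y ω), Y ω)) = ν.prod (P.map Y) := by
    refine (Measure.prod_eq fun s t hs ht => ?_).symm
    have hset : MeasurableSet {q : α × β | g q.1 q.2 ∈ s ∧ q.2 ∈ t} :=
      (hg hs).inter (measurable_snd ht)
    rw [Measure.map_apply (hgm.prodMk hY) (hs.prod ht)]
    have h1 : (fun ω => (g (X ω) (Y ω), Y ω)) ⁻¹' s ×ˢ t =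
      (fun ω => (X ω, Y ω)) ⁻¹' {q : α × β | g q.1 q.2 ∈ s ∧ q.2 ∈ t} := rfl
    rw [h1, ← Measure.map_apply (hX.prodMk hY) hset,
      (indepFun_iff_map_prod_eq_prod_map_map hX.aemeasurable hY.aemeasurable).1 hXY,
      Measure.prod_apply_symm hset]
    have h2 : ∀ y, P.map X ((fun a => (a, y)) ⁻¹' {q : α × β | g q.1 q.2 ∈ s ∧ q.2 ∈ t}) =
        t.indicator (fun _ => ν s) y := fun y => by
      by_cases hy : y ∈ t
      · rw [Set.indicator_of_mem hy, ← hν y, Measure.map_apply _ hs]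
        · congr 1
          ext a
          simp [hy]
        · exact hg.comp (measurable_id.prodMk measurable_const)
      · rw [Set.indicator_of_notMem hy]
        simp [hy]
    simp_rw [h2]
    rw [lintegral_indicator_const ht]
  have hlaw : P.map (fun ω => g (X ω) (Y ω)) = ν := by
    have h3 := congrArg (Measure.map Prod.fst) hjoint
    rwa [Measure.map_map measurable_fst (hgm.prodMk hY), Measure.map_fst_prod, measure_univ,
      one_smul] at h3
  refine ⟨?_, hlaw⟩
  rw [indepFun_iff_map_prod_eq_prod_map_map hgm.aemeasurable hY.aemeasurable, hlaw]
  exact hjoint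

end Independence

/-! ### Directions chosen from the history -/

section History

variable {Ω α β : Type*} [MeasurableSpace Ω] [MeasurableSpace α] [MeasurableSpace β]

/-- The values of the process `V` before time `t`. -/
def history (V : ℕ → Ω → α) (t : ℕ) (ω : Ω) : Finset.range t → α := fun s => V s ω

/-- A finite history, continued by zero. -/
def extendHistory [Zero α] (t : ℕ) (h : Finset.range t → α) : ℕ → α :=
  fun s => if hs : s ∈ Finset.range t then h ⟨s, hs⟩ else 0

theorem measurable_history {V : ℕ → Ω → α} (hV : ∀ t, Measurable (V t)) (t : ℕ) :
    Measurable (history V t) :=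
  measurable_pi_iff.2 fun s => hV s

theorem measurable_extendHistory [Zero α] (t : ℕ) :
    Measurable (extendHistory t : (Finset.range t → α) → ℕ → α) := by
  refine measurable_pi_iff.2 fun s => ?_
  by_cases hs : s ∈ Finset.range t
  · simpa [extendHistory, hs] using measurable_pi_apply (⟨s, hs⟩ : Finset.range t)
  · simp [extendHistory, hs]

theorem indepFun_history {P : Measure Ω} {V : ℕ → Ω → α} (hV : ∀ t, Measurable (V t))
    (hindep : iIndepFun V P) (t : ℕ) : V t ⟂ᵢ[P] history V t := by
  have h := hindep.indepFun_finset {t} (Finset.range t) (by simp) hV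
  exact h.comp (measurable_pi_apply (⟨t, Finset.mem_singleton_self t⟩ : ({t} : Finset ℕ)))
    measurable_id

end History

section Directions

variable {Ω : Type*} [MeasurableSpace Ω] {P : Measure Ω} [IsProbabilityMeasure P] {n k : ℕ}
  {hkn : k ≤ n} {V : ℕ → Ω → Fin k → EuclideanSpace ℝ (Fin n)} {e : EuclideanSpace ℝ (Fin n)}
  {u : (t : ℕ) → (Finset.range t → Fin k → EuclideanSpace ℝ (Fin n)) → EuclideanSpace ℝ (Fin n)}

/-- The direction `u t` depends on the past, yet the projection length does not: given the past, its
law is the same for every unit vector. -/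
theorem indepFun_projSq_history (hV : ∀ t, Measurable (V t))
    (hlaw : ∀ t, P.map (V t) = stiefelUniform hkn) (hindep : iIndepFun V P)
    (hu : ∀ t, Measurable (u t)) (he : ‖e‖ = 1) (hu1 : ∀ t h, ‖u t h‖ = 1) (t : ℕ) :
    (fun ω => projSq (V t ω) (u t (history V t ω))) ⟂ᵢ[P] history V t ∧
    P.map (fun ω => projSq (V t ω) (u t (history V t ω))) =
      (stiefelUniform hkn).map fun v => projSq v e := by
  have := Measure.isProbabilityMeasure_map (μ := stiefelUniform (k := k) hkn)
    (measurable_projSq_left e).aemeasurable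
  refine indepFun_of_map_const (g := fun v h => projSq v (u t h)) (hV t) (measurable_history hV t)
    (indepFun_history hV hindep t) ?_ fun h => ?_
  · exact measurable_fst.projSq ((hu t).comp measurable_snd)
  · rw [hlaw]
    exact map_projSq_eq hkn (by rw [hu1, he])

theorem measurable_projSq_history (hV : ∀ t, Measurable (V t)) (hu : ∀ t, Measurable (u t))
    (t : ℕ) : Measurable fun ω => projSq (V t ω) (u t (history V t ω)) :=
  (hV t).projSq ((hu t).comp (measurable_history hV t))

/-- The strong law of large numbers for the projection lengths of directions that depend on the
past only. -/
theorem ae_tendsto_average_projSq (hV : ∀ t, Measurable (V t))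
    (hlaw : ∀ t, P.map (V t) = stiefelUniform hkn) (hindep : iIndepFun V P)
    (hu : ∀ t, Measurable (u t)) (he : ‖e‖ = 1) (hu1 : ∀ t h, ‖u t h‖ = 1) :
    ∀ᵐ ω ∂P, Tendsto (fun t : ℕ =>
      (∑ s ∈ Finset.range t, projSq (V s ω) (u s (history V s ω))) / (t : ℝ)) atTop
      (𝓝 (∫ v, projSq v e ∂stiefelUniform hkn)) := by
  set R : ℕ → Ω → ℝ := fun t ω => projSq (V t ω) (u t (history V t ω)) with hR
  have hRm : ∀ t, Measurable (R t) := measurable_projSq_history hV hu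
  have hRI := indepFun_projSq_history hV hlaw hindep hu he hu1
  -- For `s < t`, `R s` is a function of the history before `t`. Pairwise independence suffices for
  -- the strong law used here.
  have hlt : ∀ s t, s < t → R t ⟂ᵢ[P] R s := fun s t hst => by
    have hsub : Finset.range s ⊆ Finset.range t := Finset.range_subset_range.2 hst.le
    have hψ : Measurable fun h : Finset.range t → Fin k → EuclideanSpace ℝ (Fin n) =>
        projSq (h ⟨s, Finset.mem_range.2 hst⟩) (u s fun i => h ⟨i, hsub i.2⟩) :=
      (measurable_pi_apply _).projSq
        ((hu s).comp (measurable_pi_iff.2 fun i => measurable_pi_apply _))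
    exact (hRI t).1.comp measurable_id hψ
  have hpair : Pairwise (Function.onFun (fun X Y => X ⟂ᵢ[P] Y) R) := fun s t hst => by
    rcases lt_or_gt_of_ne hst with h | h
    · exact (hlt s t h).symm
    · exact hlt t s h
  have hid : ∀ t, IdentDistrib (R t) (R 0) P P := fun t =>
    ⟨(hRm t).aemeasurable, (hRm 0).aemeasurable, (hRI t).2.trans (hRI 0).2.symm⟩
  have hint : Integrable (R 0) P := by
    refine Integrable.of_bound (hRm 0).aestronglyMeasurable 1 ?_
    have h1 : ∀ᵐ v ∂P.map (V 0), Orthonormal ℝ v := hlaw 0 ▸ ae_orthonormal_stiefelUniform hkn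
    filter_upwards [ae_of_ae_map (hV 0).aemeasurable h1] with ω hω
    rw [Real.norm_of_nonneg (projSq_nonneg _ _)]
    simpa [hu1] using projSq_le hω (u 0 (history V 0 ω))
  have hmean : ∫ ω, R 0 ω ∂P = ∫ v, projSq v e ∂stiefelUniform hkn := by
    rw [← integral_map (f := fun r : ℝ => r) (hRm 0).aemeasurable (by fun_prop),
      ← integral_map (f := fun r : ℝ => r) (measurable_projSq_left e).aemeasurable (by fun_prop),
      (hRI 0).2]
  rw [← hmean]
  exact strong_law_ae_real R hint hpair hid

/-- Summability of the squared projections of vectors that depend on the past only forces these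
vectors to tend to zero. -/
theorem ae_tendsto_zero_of_sum_projSq_le (hk : 0 < k) (hV : ∀ t, Measurable (V t))
    (hlaw : ∀ t, P.map (V t) = stiefelUniform hkn) (hindep : iIndepFun V P)
    (hu : ∀ t, Measurable (u t)) (he : ‖e‖ = 1) (hu1 : ∀ t h, ‖u t h‖ = 1)
    {G : (t : ℕ) → (Finset.range t → Fin k → EuclideanSpace ℝ (Fin n)) → ℝ}
    (hG : ∀ t, Measurable (G t)) {C : ℝ}
    (hC : ∀ᵐ ω ∂P, ∀ N, ∑ t ∈ Finset.range N,
      projSq (V t ω) (u t (history V t ω)) * G t (history V t ω) ^ 2 ≤ C) :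
    ∀ᵐ ω ∂P, Tendsto (fun t => G t (history V t ω)) atTop (𝓝 0) := by
  have hRm := measurable_projSq_history hV hu
  have hRI := indepFun_projSq_history hV hlaw hindep hu he hu1
  set A : ℕ → Ω → ENNReal := fun t ω => ENNReal.ofReal (G t (history V t ω) ^ 2) with hA
  set r : ℕ → Ω → ENNReal :=
    fun t ω => ENNReal.ofReal (projSq (V t ω) (u t (history V t ω))) with hr
  have hAm : ∀ t, Measurable (A t) := fun t =>
    (((hG t).comp (measurable_history hV t)).pow_const 2).ennreal_ofReal
  have hrm : ∀ t, Measurable (r t) := fun t => (hRm t).ennreal_ofReal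
  set m : ENNReal := ∫⁻ v, ENNReal.ofReal (projSq v e) ∂stiefelUniform (k := k) hkn with hm
  have hm0 : m ≠ 0 := fun h0 => by
    have h1 := integral_projSq_pos hk hkn he
    rw [integral_eq_lintegral_of_nonneg_ae (Eventually.of_forall fun v => projSq_nonneg v e)
      (measurable_projSq_left e).aestronglyMeasurable, ← hm, h0] at h1
    simp at h1
  have hrmean : ∀ t, ∫⁻ ω, r t ω ∂P = m := fun t => by
    rw [hm, ← lintegral_map (f := ENNReal.ofReal) ENNReal.measurable_ofReal
      (measurable_projSq_left e), ← (hRI t).2, lintegral_map ENNReal.measurable_ofReal (hRm t)]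
  -- Independence factors the expectation. In `ENNReal` this needs no prior integrability of `G`;
  -- finiteness of the sum follows from `m ≠ 0`.
  have hprod : ∀ t, ∫⁻ ω, r t ω * A t ω ∂P = m * ∫⁻ ω, A t ω ∂P := fun t => by
    have hI : r t ⟂ᵢ[P] A t :=
      (hRI t).1.comp ENNReal.measurable_ofReal ((hG t).pow_const 2).ennreal_ofReal
    rw [← hrmean t]
    exact lintegral_mul_eq_lintegral_mul_lintegral_of_indepFun (hrm t) (hAm t) hI
  have hsum : m * ∑' t, ∫⁻ ω, A t ω ∂P ≤ ENNReal.ofReal C := by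
    rw [← ENNReal.tsum_mul_left]
    refine ENNReal.tsum_le_of_sum_range_le fun N => ?_
    calc ∑ t ∈ Finset.range N, m * ∫⁻ ω, A t ω ∂P
        = ∫⁻ ω, ∑ t ∈ Finset.range N, r t ω * A t ω ∂P := by
          rw [lintegral_finsetSum (f := fun t ω => r t ω * A t ω) _ fun t _ =>
            (hrm t).mul (hAm t)]
          exact Finset.sum_congr rfl fun t _ => (hprod t).symm
      _ ≤ ∫⁻ _, ENNReal.ofReal C ∂P := by
          refine lintegral_mono_ae ?_
          filter_upwards [hC] with ω hω
          refine le_trans (le_of_eq ?_) (ENNReal.ofReal_le_ofReal (hω N))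
          rw [ENNReal.ofReal_sum_of_nonneg fun t _ =>
            mul_nonneg (projSq_nonneg _ _) (sq_nonneg _)]
          exact Finset.sum_congr rfl fun t _ => (ENNReal.ofReal_mul (projSq_nonneg _ _)).symm
      _ = ENNReal.ofReal C := by simp
  have hfin : ∫⁻ ω, ∑' t, A t ω ∂P ≠ ⊤ := by
    rw [lintegral_tsum fun t => (hAm t).aemeasurable]
    intro htop
    rw [htop, ENNReal.mul_top hm0] at hsum
    exact absurd hsum (by simp)
  filter_upwards [ae_lt_top (Measurable.tsum hAm) hfin] with ω hω
  have h1 := ENNReal.tendsto_atTop_zero_of_tsum_ne_top hω.ne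
  have h2 : Tendsto (fun t => G t (history V t ω) ^ 2) atTop (𝓝 0) := by
    have h3 := (ENNReal.tendsto_toReal ENNReal.zero_ne_top).comp h1
    refine h3.congr fun t => ?_
    simp [hA, sq_nonneg]
  have h4 := h2.sqrt
  simp only [Real.sqrt_sq_eq_abs, Real.sqrt_zero] at h4
  exact (tendsto_zero_iff_abs_tendsto_zero _).2 h4

end Directions

/-! ### The iterates as functions of the history -/

section Iterates

variable {n k : ℕ} {f : EuclideanSpace ℝ (Fin n) → ℝ} {η δ₀ : ℝ} {x₀ : EuclideanSpace ℝ (Fin n)}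

theorem continuous_gradEst (hf : Continuous f) (δ : ℝ) :
    Continuous fun p : (Fin k → EuclideanSpace ℝ (Fin n)) × EuclideanSpace ℝ (Fin n) =>
      gradEst f δ p.1 p.2 := by
  unfold gradEst
  fun_prop

theorem measurable_szgd (hf : Continuous f) (t : ℕ) :
    Measurable fun v : ℕ → Fin k → EuclideanSpace ℝ (Fin n) => szgd f η δ₀ x₀ v t := by
  induction t with
  | zero => exact measurable_const
  | succ t ih =>
    exact ih.sub (((continuous_gradEst hf _).measurable.comp
      ((measurable_pi_apply t).prodMk ih)).const_smul η)

theorem szgd_congr {v w : ℕ → Fin k → EuclideanSpace ℝ (Fin n)} {t : ℕ}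
    (h : ∀ s < t, v s = w s) : szgd f η δ₀ x₀ v t = szgd f η δ₀ x₀ w t := by
  induction t with
  | zero => rfl
  | succ t ih =>
    rw [szgd, szgd, ih fun s hs => h s (by omega), h t t.lt_succ_self]

/-- The iterate at time `t` uses only frames before `t`, so it is a function of the history and the
padding by zero is harmless. -/
theorem szgd_extendHistory {Ω : Type*} (V : ℕ → Ω → Fin k → EuclideanSpace ℝ (Fin n)) (t : ℕ)
    (ω : Ω) : szgd f η δ₀ x₀ (extendHistory t (history V t ω)) t =
      szgd f η δ₀ x₀ (fun s => V s ω) t :=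
  szgd_congr fun s hs => by simp [extendHistory, history, hs]

/-- The direction of `w`, or `e` if `w = 0`. -/
noncomputable def unitDirection (e w : EuclideanSpace ℝ (Fin n)) : EuclideanSpace ℝ (Fin n) :=
  open Classical in if w = 0 then e else ‖w‖⁻¹ • w

theorem measurable_unitDirection (e : EuclideanSpace ℝ (Fin n)) :
    Measurable (unitDirection e) :=
  Measurable.ite (measurableSet_singleton 0) measurable_const
    (measurable_norm.inv.smul measurable_id)

theorem norm_unitDirection {e : EuclideanSpace ℝ (Fin n)} (he : ‖e‖ = 1)
    (w : EuclideanSpace ℝ (Fin n)) : ‖unitDirection e w‖ = 1 := by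
  unfold unitDirection
  split_ifs with h
  · exact he
  · exact norm_smul_inv_norm (𝕜 := ℝ) h

theorem norm_smul_unitDirection (e w : EuclideanSpace ℝ (Fin n)) :
    ‖w‖ • unitDirection e w = w := by
  unfold unitDirection
  split_ifs with h
  · simp [h]
  · rw [smul_smul, mul_inv_cancel₀ (norm_ne_zero_iff.2 h), one_smul]

end Iterates

/-- A bounded descent path along which the gradient tends to zero converges if `f` is a Lojasiewicz
function. -/
theorem IsDescentPath.exists_tendsto {n : ℕ} {f : EuclideanSpace ℝ (Fin n) → ℝ} {a H D ρ θ : ℝ}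
    {x : ℕ → EuclideanSpace ℝ (Fin n)} {R : ℕ → ℝ} (h : IsDescentPath f a H D x R)
    (ha : 0 < a) (hH : 0 < H) (hD : 0 < D) (hρ : 0 < ρ) (hθ : θ ∈ Set.Ioo (0 : ℝ) 1)
    (hf : Continuous f) (hf' : Continuous (gradient f)) (hloj : IsLojasiewicz f θ)
    (hbdd : BddBelow (Set.range f))
    (hR : Tendsto (fun t : ℕ => (∑ s ∈ Finset.range t, R s) / (t : ℝ)) atTop (𝓝 ρ))
    (hx : Bornology.IsBounded (Set.range x))
    (hgrad : Tendsto (fun t => gradient f (x t)) atTop (𝓝 0)) :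
    ∃ p, Tendsto x atTop (𝓝 p) ∧ gradient f p = 0 := by
  obtain ⟨l, hl, hlt⟩ := h.exists_limit_value ha hH hbdd
  -- No limit point is singled out yet, so the constant comes from compactness.
  obtain ⟨K, hK, hev⟩ := exists_eventually_lojasiewicz hf hf' hloj hx hl hgrad
  have hc : CauchySeq x := by
    rcases le_or_gt θ (1 / 2) with hθ' | hθ'
    · obtain ⟨Q, -, hQ⟩ := IsDescentPath.exists_linear_rate (f := f) ha hH hD hK hρ
      exact (hQ x R l h hR hlt (eventually_lojasiewicz_half hθ.1 hθ' hl hev)).1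
    · exact (h.cauchySeq_and_isBigO ha hH hD hK hρ ⟨hθ', hθ.2⟩ hR hlt hev).1
  obtain ⟨p, hp⟩ := cauchySeq_tendsto_of_complete hc
  exact ⟨p, hp, tendsto_nhds_unique ((hf'.tendsto p).comp hp) hgrad⟩

/-- Almost every trajectory of the algorithm is a descent path with averaging projection lengths
and vanishing gradients. -/
theorem exists_ae_isDescentPath {Ω : Type*} [MeasurableSpace Ω] {P : Measure Ω}
    [IsProbabilityMeasure P] {n k : ℕ} (hk : 0 < k) (hkn : k ≤ n)
    {f : EuclideanSpace ℝ (Fin n) → ℝ} {L η δ₀ : ℝ} (hL : 0 < L) (hf : IsLSmooth f L)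
    (hbdd : BddBelow (Set.range f)) (hη : η ∈ Set.Ioo (0 : ℝ) (2 * k / (L * n)))
    (hδ₀ : δ₀ ∈ Set.Ioc (0 : ℝ) 1) (x₀ : EuclideanSpace ℝ (Fin n))
    {V : ℕ → Ω → Fin k → EuclideanSpace ℝ (Fin n)} (hV : ∀ t, Measurable (V t))
    (hlaw : ∀ t, P.map (V t) = stiefelUniform hkn) (hindep : iIndepFun V P) :
    ∃ a H D ρ : ℝ, 0 < a ∧ 0 < H ∧ 0 < D ∧ 0 < ρ ∧ ∀ᵐ ω ∂P, ∃ R : ℕ → ℝ,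
      IsDescentPath f a H D (szgd f η δ₀ x₀ fun s => V s ω) R ∧
      Tendsto (fun t : ℕ => (∑ s ∈ Finset.range t, R s) / (t : ℝ)) atTop (𝓝 ρ) ∧
      Tendsto (fun t => gradient f (szgd f η δ₀ x₀ (fun s => V s ω) t)) atTop (𝓝 0) := by
  obtain ⟨a, H, D, ha, hH, hD, hstep⟩ := exists_lyapunov hk hkn hL hf hη hδ₀
  obtain ⟨m, hm⟩ := hbdd
  -- A reference unit vector: it fixes the common law of the projection lengths and stands in for
  -- the gradient direction where the gradient vanishes.
  set e : EuclideanSpace ℝ (Fin n) := EuclideanSpace.single ⟨0, hk.trans_le hkn⟩ 1 with he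
  have he1 : ‖e‖ = 1 := by simp [he]
  set g : (t : ℕ) → (Finset.range t → Fin k → EuclideanSpace ℝ (Fin n)) →
    EuclideanSpace ℝ (Fin n) := fun t h => gradient f (szgd f η δ₀ x₀ (extendHistory t h) t) with hg
  have hgm : ∀ t, Measurable (g t) := fun t =>
    (hf.continuous_gradient hL.le).measurable.comp
      ((measurable_szgd hf.1.continuous t).comp (measurable_extendHistory t))
  have hgV : ∀ t ω, g t (history V t ω) = gradient f (szgd f η δ₀ x₀ (fun s => V s ω) t) :=
    fun t ω => by rw [hg]; simp only [szgd_extendHistory]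
  set u : (t : ℕ) → (Finset.range t → Fin k → EuclideanSpace ℝ (Fin n)) →
    EuclideanSpace ℝ (Fin n) := fun t h => unitDirection e (g t h) with hu
  have hum : ∀ t, Measurable (u t) := fun t => (measurable_unitDirection e).comp (hgm t)
  have hu1 : ∀ t h, ‖u t h‖ = 1 := fun t h => norm_unitDirection he1 _
  have horth : ∀ᵐ ω ∂P, ∀ t, Orthonormal ℝ (V t ω) := ae_all_iff.2 fun t => by
    have h1 : ∀ᵐ v ∂P.map (V t), Orthonormal ℝ v := hlaw t ▸ ae_orthonormal_stiefelUniform hkn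
    exact ae_of_ae_map (hV t).aemeasurable h1
  have hpath : ∀ᵐ ω ∂P, IsDescentPath f a H D (szgd f η δ₀ x₀ fun s => V s ω)
      (fun t => projSq (V t ω) (u t (history V t ω))) := by
    filter_upwards [horth] with ω hω
    have hZ : ∀ t, projSq (V t ω) (gradient f (szgd f η δ₀ x₀ (fun s => V s ω) t)) =
        projSq (V t ω) (u t (history V t ω)) *
          ‖gradient f (szgd f η δ₀ x₀ (fun s => V s ω) t)‖ ^ 2 := fun t => by
      rw [← hgV, ← projSq_smul, hu]
      simp only [norm_smul_unitDirection]
    refine ⟨fun t => ⟨projSq_nonneg _ _, ?_⟩, fun t => ?_, fun t => ?_⟩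
    · simpa [hu1] using projSq_le (hω t) (u t (history V t ω))
    · rw [← hZ]
      exact (hstep x₀ _ hω t).1
    · rw [← hZ]
      exact (hstep x₀ _ hω t).2
  have hgrad := ae_tendsto_zero_of_sum_projSq_le hk hV hlaw hindep hum he1 hu1
    (G := fun t h => ‖g t h‖) (fun t => (hgm t).norm) (C := (f x₀ + H - m) / a) (by
      filter_upwards [hpath] with ω hω N
      have := hω.sum_le ha hH (fun y => hm ⟨y, rfl⟩) N
      simpa only [hgV, szgd] using this)
  refine ⟨a, H, D, _, ha, hH, hD, integral_projSq_pos hk hkn he1, ?_⟩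
  filter_upwards [hpath, hgrad, ae_tendsto_average_projSq hV hlaw hindep hum he1 hu1]
    with ω h1 h2 h3
  refine ⟨_, h1, h3, ?_⟩
  rw [tendsto_zero_iff_norm_tendsto_zero]
  simpa only [hgV] using h2

theorem theorem5 {Ω : Type*} [MeasurableSpace Ω] (P : Measure Ω) [IsProbabilityMeasure P]
    {n k : ℕ} (hk : 0 < k) (hkn : k ≤ n)
    (f : EuclideanSpace ℝ (Fin n) → ℝ) (L θ : ℝ) (hL : 0 < L) (hsmooth : IsLSmooth f L)
    (hθ : θ ∈ Set.Ioo (0 : ℝ) 1) (hloj : IsLojasiewicz f θ)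
    (hbdd : BddBelow (Set.range f))
    (η δ₀ : ℝ) (hη : η ∈ Set.Ioo (0 : ℝ) (2 * k / (L * n))) (hδ₀ : δ₀ ∈ Set.Ioc (0 : ℝ) 1)
    (x₀ : EuclideanSpace ℝ (Fin n))
    (V : ℕ → Ω → Fin k → EuclideanSpace ℝ (Fin n)) (hVmeas : ∀ t, Measurable (V t))
    (hVlaw : ∀ t, P.map (V t) = stiefelUniform hkn) (hVindep : iIndepFun V P)
    (x : ℕ → Ω → EuclideanSpace ℝ (Fin n))
    (hx : ∀ t ω, x t ω = szgd f η δ₀ x₀ (fun s => V s ω) t)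
    (hxbdd : ∀ᵐ ω ∂P, Bornology.IsBounded (Set.range fun t => x t ω)) :
    ∃ xlim : Ω → EuclideanSpace ℝ (Fin n), Measurable xlim ∧
      (∀ᵐ ω ∂P, Tendsto (fun t => x t ω) atTop (𝓝 (xlim ω)) ∧ gradient f (xlim ω) = 0) ∧
      (θ ∈ Set.Ioc (0 : ℝ) (1 / 2) →
        -1 ≤ L * n * η ^ 2 / (2 * k) - η → L * n * η ^ 2 / (2 * k) - η < 0 →
          (∀ κ : ℝ, 0 < κ → IsLojasiewiczWith f θ κ →
            ∃ Q : ℝ, 1 < Q ∧ ∀ᵐ ω ∂P,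
              Tendsto (fun t : ℕ => Q ^ t * ‖x t ω - xlim ω‖) atTop (𝓝 0)) ∧
          (∀ᵐ ω ∂P, ∃ Q : ℝ, 1 < Q ∧
              Tendsto (fun t : ℕ => Q ^ t * ‖x t ω - xlim ω‖) atTop (𝓝 0))) ∧
      (θ ∈ Set.Ioo (1 / 2 : ℝ) 1 →
        ∀ᵐ ω ∂P, (fun t : ℕ => ‖x t ω - xlim ω‖) =O[atTop]
          (fun t : ℕ => (t : ℝ) ^ ((1 - θ) / (1 - 2 * θ)))) := by

  obtain ⟨a, H, D, ρ, ha, hH, hD, hρ, hpath⟩ :=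
    exists_ae_isDescentPath hk hkn hL hsmooth hbdd hη hδ₀ x₀ hVmeas hVlaw hVindep
  have hxeq : ∀ ω, (fun t => x t ω) = szgd f η δ₀ x₀ fun s => V s ω := fun ω =>
    funext fun t => hx t ω
  have hf : Continuous f := hsmooth.1.continuous
  have hf' : Continuous (gradient f) := hsmooth.continuous_gradient hL.le
  have hxm : ∀ t, Measurable (x t) := fun t => by
    rw [show x t = fun ω => szgd f η δ₀ x₀ (fun s => V s ω) t from funext fun ω => hx t ω]
    exact (measurable_szgd hf t).comp (measurable_pi_iff.2 hVmeas)
  have hconv : ∀ᵐ ω ∂P, ∃ p, Tendsto (fun t => x t ω) atTop (𝓝 p) ∧ gradient f p = 0 := by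
    filter_upwards [hpath, hxbdd] with ω ⟨R, h, hR, hgrad⟩ hb
    rw [hxeq] at hb ⊢
    exact h.exists_tendsto ha hH hD hρ hθ hf hf' hloj hbdd hR hb hgrad
  obtain ⟨xlim, hlimm, hlim⟩ := measurable_limit_of_tendsto_metrizable_ae
    (fun t => (hxm t).aemeasurable) (hconv.mono fun ω ⟨p, hp, _⟩ => ⟨p, hp⟩)
  have hcrit : ∀ᵐ ω ∂P, Tendsto (fun t => x t ω) atTop (𝓝 (xlim ω)) ∧
      gradient f (xlim ω) = 0 := by
    filter_upwards [hlim, hconv] with ω h1 ⟨p, hp, hp0⟩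
    exact ⟨h1, tendsto_nhds_unique h1 hp ▸ hp0⟩
  have hvalue : ∀ᵐ ω ∂P, ∃ R : ℕ → ℝ,
      IsDescentPath f a H D (fun t => x t ω) R ∧
      Tendsto (fun t : ℕ => (∑ s ∈ Finset.range t, R s) / (t : ℝ)) atTop (𝓝 ρ) ∧
      Tendsto (fun t => f (x t ω)) atTop (𝓝 (f (xlim ω))) ∧
      ∀ t, f (xlim ω) < f (x t ω) + H * (1 / 4) ^ t := by
    filter_upwards [hpath, hlim] with ω ⟨R, h, hR, _⟩ hp
    rw [← hxeq] at h
    obtain ⟨l, hl, hlt⟩ := h.exists_limit_value ha hH hbdd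
    have hl' := (hf.tendsto _).comp hp
    have : l = f (xlim ω) := tendsto_nhds_unique hl hl'
    exact ⟨R, h, hR, hl', this ▸ hlt⟩
  refine ⟨xlim, hlimm, hcrit, fun hθ' _ _ => ⟨fun κ hκ hlojκ => ?_, ?_⟩, fun hθ' => ?_⟩
  -- Here `κ` is common to all critical points, so `Q` is fixed before `ω`; in the next case both
  -- depend on the limit.
  · obtain ⟨Q, hQ1, hQ⟩ := IsDescentPath.exists_linear_rate (f := f) ha hH hD hκ hρ
    refine ⟨Q, hQ1, ?_⟩
    filter_upwards [hvalue, hcrit] with ω ⟨R, h, hR, hl, hlt⟩ ⟨hp, hp0⟩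
    have hev := eventually_lojasiewicz_of_tendsto hp (hlojκ.2 _ hp0)
    simpa only [dist_eq_norm] using (hQ _ R _ h hR hlt
      (eventually_lojasiewicz_half hθ'.1 hθ'.2 hl hev)).2 _ hp
  · filter_upwards [hvalue, hcrit] with ω ⟨R, h, hR, hl, hlt⟩ ⟨hp, hp0⟩
    obtain ⟨κ, hκ, hlojκ⟩ := hloj.2 _ hp0
    obtain ⟨Q, hQ1, hQ⟩ := IsDescentPath.exists_linear_rate (f := f) ha hH hD hκ hρ
    have hev := eventually_lojasiewicz_of_tendsto hp hlojκ
    exact ⟨Q, hQ1, by simpa only [dist_eq_norm] using (hQ _ R _ h hR hlt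
      (eventually_lojasiewicz_half hθ'.1 hθ'.2 hl hev)).2 _ hp⟩
  · filter_upwards [hvalue, hcrit] with ω ⟨R, h, hR, hl, hlt⟩ ⟨hp, hp0⟩
    obtain ⟨κ, hκ, hlojκ⟩ := hloj.2 _ hp0
    have hev := eventually_lojasiewicz_of_tendsto hp hlojκ
    simpa only [dist_eq_norm] using
      (h.cauchySeq_and_isBigO ha hH hD hκ hρ hθ' hR hlt hev).2 _ hp
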